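/- A length space is a metric space in which the distance between any two points is the infimum of the lengths of the curves joining them. A map $f:X\to Y$ between length spaces is a path isometry if $\operatorname{length}(f\circ\gamma)=\operatorname{length}(\gamma)\in[0,\infty]$ for every curve $\gamma$ in $X$. A pseudo-arc is a hereditarily indecomposable chainable metric continuum with more than one point. Let $\dim$ denote the Lebesgue covering dimension. (1) There exist a compact length space $X$ and a path isometry $f:X\to\mathbb{R}$ such that $f^{-1}(0)$ is connected and has more than one point; moreover, $f^{-1}(0)$ can be taken homeomorphic to a pseudo-arc. (2) The dimension of $f^{-1}(0)$ can be made arbitrarily large: for every integer $m\ge 1$ there exist a compact length space $X$ and a path isometry $f:X\to\mathbb{R}$ such that $f^{-1}(0)$ is connected, has more than one point, satisfies $\dim f^{-1}(0)\ge m$, and is homeomorphic to the product $P^m$ of $m$ copies of a pseudo-arc $P$. (3) Consequently, for every $d\ge 1$ it is not true that every compact length space $X$ admitting a path isometry to the Euclidean space $\mathbb{E}^d$ satisfies $\dim X\le d$. -/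

import Mathlib

open Set
open scoped unitInterval

noncomputable section

/-- The length of a curve `γ : [0,1] → X` in a metric space: the supremum over all subdivisions
`t₀ ≤ t₁ ≤ … ≤ tₙ` of `∑ |γ(tᵢ₋₁) γ(tᵢ)|`. It takes values in `[0,∞]`. -/
def curveLength {X : Type*} [PseudoEMetricSpace X] (γ : I → X) : ENNReal :=
  eVariationOn γ univ

/-- A length space (a space with inner metric): the distance between any two points is the infimum
of the lengths of the curves joining them. All distances are finite, so any two points are joined
by a curve (the infimum over the empty set is `∞`). -/
def IsLengthSpace (X : Type*) [MetricSpace X] : Prop :=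
  ∀ x y : X, edist x y = ⨅ γ : Path x y, curveLength γ

/-- A path isometry: a map that preserves the length (finite or infinite) of every curve. -/
def IsPathIsometry {X Y : Type*} [MetricSpace X] [MetricSpace Y] (f : X → Y) : Prop :=
  ∀ γ : C(I, X), curveLength γ = curveLength (f ∘ γ)

/-- Lebesgue covering dimension at most `n`: every finite open cover has a finite open refinement
such that no point lies in more than `n + 1` of its members. -/
def HasLebesgueDimLE (X : Type*) [TopologicalSpace X] (n : ℕ) : Prop :=
  ∀ U : Set (Set X), U.Finite → (∀ u ∈ U, IsOpen u) → ⋃₀ U = univ →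
    ∃ V : Set (Set X), V.Finite ∧ (∀ v ∈ V, IsOpen v) ∧ ⋃₀ V = univ ∧
      (∀ v ∈ V, ∃ u ∈ U, v ⊆ u) ∧ ∀ x : X, {v ∈ V | x ∈ v}.encard ≤ n + 1

open Classical in
/-- The Lebesgue covering dimension: `⊥` (that is, `-1`) for the empty space, otherwise the least
`n` such that the dimension is at most `n`, and `⊤` if there is none. -/
def lebesgueDim (X : Type*) [TopologicalSpace X] : WithBot ℕ∞ :=
  if IsEmpty X then ⊥ else ((⨅ n : {n : ℕ // HasLebesgueDimLE X n}, (n.1 : ℕ∞) : ℕ∞) : WithBot ℕ∞)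

/-- A subcontinuum of a metric space: a nonempty compact connected subset. -/
def IsSubcontinuum {X : Type*} [TopologicalSpace X] (K : Set X) : Prop :=
  IsCompact K ∧ IsConnected K

/-- Hereditary indecomposability: no subcontinuum is the union of two proper subcontinua. -/
def IsHereditarilyIndecomposable (X : Type*) [TopologicalSpace X] : Prop :=
  ∀ K A B : Set X, IsSubcontinuum K → IsSubcontinuum A → IsSubcontinuum B →
    A ∪ B = K → A = K ∨ B = K

/-- Chainability: for every `ε > 0` the space is covered by a finite chain `U₀, …, Uₙ` of nonempty
open sets of diameter at most `ε`, where `Uᵢ` meets `Uⱼ` if and only if `|i - j| ≤ 1`. -/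
def IsChainable (X : Type*) [MetricSpace X] : Prop :=
  ∀ ε : ℝ, 0 < ε → ∃ (n : ℕ) (U : Fin (n + 1) → Set X),
    (∀ i, IsOpen (U i)) ∧ (∀ i, ∀ x ∈ U i, ∀ y ∈ U i, dist x y ≤ ε) ∧ (⋃ i, U i) = univ ∧
      ∀ i j : Fin (n + 1), (U i ∩ U j).Nonempty ↔ (i : ℕ) ≤ j + 1 ∧ (j : ℕ) ≤ i + 1

/-- A pseudo-arc: a hereditarily indecomposable chainable metric continuum with more than one
point. -/
structure IsPseudoArc (P : Type*) [MetricSpace P] : Prop where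
  compact : CompactSpace P
  connected : ConnectedSpace P
  nontrivial : Nontrivial P
  chainable : IsChainable P
  hereditarilyIndecomposable : IsHereditarilyIndecomposable P

end

/-!
The space `X` is a tree that accumulates on the power `P^m` of a pseudo-arc `P`, with a metric that
is forced to make the height a path isometry.

Let `T₀ ← T₁ ← T₂ ← ⋯` be finite paths with crooked bonding maps (`CrookedSystem`). Their inverse
limit is a Cantor set of threads, and identifying threads that are equal or adjacent at every level
gives `P`: it is chainable since the levels are paths, and hereditarily indecomposable since the
bonding maps are crooked (`Cone.isPseudoArc_fiber`). The families of `m` threads are the ends of a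
tree whose vertices at height `2⁻⁽ᵏ⁺¹⁾` are the `m`-tuples of vertices of `Tₖ`; gluing its ends, at
height `0`, in the same way gives a compact space, `Cone S ι`, whose fibre at height `0` is `P^m`
(`Cone.nonempty_fiber_homeomorph_pi`).

Define the distance of two points as the infimum, over all paths joining them, of the variation of
the height (`pathEDist`). If this is a metric inducing the given topology, then the cone is a length
space and the height a path isometry for formal reasons: the distance of `γ s` and `γ t` is at most
the variation of the height along `γ` between `s` and `t`, and at least the difference of heights
(`Cone.isPathIsometry_height`, `Cone.isLengthSpace`). Points that are close in the cone are joined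
through a common vertex of small height, so what remains is that distinct points of `P^m` are not
joined by paths of arbitrarily small height variation. This is where crookedness enters
(`Cone.le_eVariationOn_height`). Below height `2⁻ᵏ` the level-`k` value of a point moves continuously
along the path `Tₖ`, and changes only at height `0`. So a path of small variation that traverses
level `k` traverses level `k + 1` as well, and by crookedness it then crosses level `k` three times;
one of these crossings uses up at most half of the variation and half of the parameter interval.
Repeating this on higher and higher levels yields oscillations of fixed size on arbitrarily short
intervals, which contradicts continuity.

For the dimension, a space of dimension at most `n` has fine covers by `n + 1` families of disjoint
open sets. If `n + 1 ≤ m`, assigning a coordinate direction of `P^m` to each of the families produces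
functions on a fine grid, mapped to `P^m` by chains of threads, that contradict a discrete form of
the Poincaré–Miranda theorem (`exists_cube_forall_ne`). The latter is Stokes' theorem for the cubical
cup product modulo `2` of the coboundaries of these functions. Finally a closed subspace has at most
the dimension of the whole space, and the line embeds isometrically in every `𝔼ᵈ` with `d ≥ 1`.
-/

/-! ### Crooked walks and inverse systems -/

/-- A walk on the integers is crooked on `[a, b]` if on the way from any time `i` to any later time
`j` it comes within `1` of its final value `w j` and afterwards within `1` of its initial value
`w i`. -/
def IsCrookedOn (w : ℤ → ℤ) (a b : ℤ) : Prop :=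
  ∀ i j, a ≤ i → i ≤ j → j ≤ b →
    ∃ k l, i ≤ k ∧ k ≤ l ∧ l ≤ j ∧ |w k - w j| ≤ 1 ∧ |w l - w i| ≤ 1

/-- Steps of size at most `1` during the time interval `[a, b]`. -/
def IsWalkOn (w : ℤ → ℤ) (a b : ℤ) : Prop :=
  ∀ i, a ≤ i → i < b → |w (i + 1) - w i| ≤ 1

theorem IsWalkOn.mono {w : ℤ → ℤ} {a b a' b' : ℤ} (h : IsWalkOn w a b) (ha : a ≤ a')
    (hb : b' ≤ b) : IsWalkOn w a' b' :=
  fun i hi hi' => h i (by omega) (by omega)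

theorem IsWalkOn.exists_eq_of_le {w : ℤ → ℤ} {i j v : ℤ} (h : IsWalkOn w i j) (hij : i ≤ j)
    (hi : w i ≤ v) (hj : v ≤ w j) : ∃ k, i ≤ k ∧ k ≤ j ∧ w k = v := by
  induction j, hij using Int.leInduction with
  | base => exact ⟨i, le_rfl, le_rfl, by omega⟩
  | succ j hij ih =>
    by_cases hv : v ≤ w j
    · obtain ⟨k, h1, h2, h3⟩ := ih (h.mono le_rfl (by omega)) hv
      exact ⟨k, h1, by omega, h3⟩
    · have := abs_le.1 (h j hij (by omega))
      exact ⟨j + 1, by omega, le_rfl, by omega⟩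

theorem IsWalkOn.exists_eq_of_ge {w : ℤ → ℤ} {i j v : ℤ} (h : IsWalkOn w i j) (hij : i ≤ j)
    (hi : v ≤ w i) (hj : w j ≤ v) : ∃ k, i ≤ k ∧ k ≤ j ∧ w k = v := by
  have h' : IsWalkOn (fun x => -w x) i j := fun x hx hx' => by
    have := abs_le.1 (h x hx hx')
    exact abs_le.2 ⟨by dsimp only; omega, by dsimp only; omega⟩
  obtain ⟨k, h1, h2, h3⟩ := h'.exists_eq_of_le hij (v := -v) (by omega) (by omega)
  exact ⟨k, h1, h2, by simpa using h3⟩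

/-- Crookedness does not depend on the direction of time. -/
theorem IsCrookedOn.comp_sub {w : ℤ → ℤ} {a b : ℤ} (h : IsCrookedOn w a b) (c d : ℤ) :
    IsCrookedOn (fun x => w (c - x) + d) (c - b) (c - a) := by
  intro i j hi hij hj
  obtain ⟨k, l, h1, h2, h3, h4, h5⟩ := h (c - j) (c - i) (by omega) (by omega) (by omega)
  refine ⟨c - l, c - k, by omega, by omega, by omega, ?_, ?_⟩
  · simpa using h5
  · simpa using h4

theorem IsCrookedOn.comp_add {w : ℤ → ℤ} {a b : ℤ} (h : IsCrookedOn w a b) (c d : ℤ) :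
    IsCrookedOn (fun x => w (x - c) + d) (a + c) (b + c) := by
  intro i j hi hij hj
  obtain ⟨k, l, h1, h2, h3, h4, h5⟩ := h (i - c) (j - c) (by omega) (by omega) (by omega)
  refine ⟨k + c, l + c, by omega, by omega, by omega, ?_, ?_⟩
  · simpa using h4
  · simpa using h5

theorem IsCrookedOn.congr {w w' : ℤ → ℤ} {a b : ℤ} (h : IsCrookedOn w a b)
    (hw : ∀ i, a ≤ i → i ≤ b → w' i = w i) : IsCrookedOn w' a b := by
  intro i j hi hij hj
  obtain ⟨k, l, h1, h2, h3, h4, h5⟩ := h i j hi hij hj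
  refine ⟨k, l, h1, h2, h3, ?_, ?_⟩
  · rwa [hw k (by omega) (by omega), hw j (by omega) (by omega)]
  · rwa [hw l (by omega) (by omega), hw i (by omega) (by omega)]

/-- Two crooked walks, the first ending and the second starting at the maximum of their union (or
both at the minimum, for `ε = -1`), form a crooked walk. -/
theorem IsCrookedOn.union {w : ℤ → ℤ} {a b c : ℤ} (ε : ℤ) (hε : ε = 1 ∨ ε = -1)
    (hw : IsWalkOn w a c) (h₁ : IsCrookedOn w a b)
    (h₂ : IsCrookedOn w b c) (hmax : ∀ i, a ≤ i → i ≤ c → ε * w i ≤ ε * w b) :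
    IsCrookedOn w a c := by
  intro i j hi hij hj
  by_cases hjb : j ≤ b
  · exact h₁ i j hi hij hjb
  by_cases hbi : b ≤ i
  · exact h₂ i j hbi hij hj
  have m1 := hmax i hi (by omega)
  have m2 := hmax j (by omega) hj
  by_cases hc : ε * w i ≤ ε * w j
  · -- on the way up to the maximum, the first walk passes the final value `w j`
    obtain ⟨k, hk1, hk2, hk3⟩ : ∃ k, i ≤ k ∧ k ≤ b ∧ w k = w j := by
      rcases hε with rfl | rfl
      · exact (hw.mono hi (by omega)).exists_eq_of_le (by omega) (by omega) (by omega)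
      · exact (hw.mono hi (by omega)).exists_eq_of_ge (by omega) (by omega) (by omega)
    obtain ⟨p, q, h1, h2, h3, h4, h5⟩ := h₁ i k hi hk1 hk2
    exact ⟨p, q, h1, h2, by omega, by rwa [← hk3], h5⟩
  · -- on the way down from the maximum, the second walk passes the initial value `w i`
    obtain ⟨k, hk1, hk2, hk3⟩ : ∃ k, b ≤ k ∧ k ≤ j ∧ w k = w i := by
      rcases hε with rfl | rfl
      · exact (hw.mono (by omega) hj).exists_eq_of_ge (by omega) (by omega) (by omega)
      · exact (hw.mono (by omega) hj).exists_eq_of_le (by omega) (by omega) (by omega)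
    obtain ⟨p, q, h1, h2, h3, h4, h5⟩ := h₂ k j hk1 hk2 hj
    exact ⟨p, q, by omega, h2, h3, h4, by rwa [← hk3]⟩

/-- There are crooked walks from `0` to `n` in `{0, …, n}`. The walk to `n + 2` goes up to `n + 1`,
back to `1`, and up to `n + 2`, each time along a crooked walk. -/
theorem exists_crooked_walk (n : ℕ) : ∃ (N : ℕ) (w : ℤ → ℤ), w 0 = 0 ∧ w N = n ∧
    (∀ i : ℤ, 0 ≤ i → i ≤ N → 0 ≤ w i ∧ w i ≤ n) ∧ IsWalkOn w 0 N ∧ IsCrookedOn w 0 N := by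
  induction n using Nat.twoStepInduction with
  | zero =>
    exact ⟨0, fun _ => 0, rfl, rfl, by simp, fun i _ _ => by simp,
      fun i j _ hij _ => ⟨i, i, by simp [hij]⟩⟩
  | one =>
    refine ⟨1, id, rfl, rfl, fun i h1 h2 => ⟨h1, h2⟩, fun i _ _ => by simp,
      fun i j h1 h2 h3 => ⟨i, i, le_rfl, le_rfl, h2, abs_le.2 ⟨?_, ?_⟩, by simp⟩⟩ <;>
    · push_cast [id] at h3 ⊢
      omega
  | more n ih2 ih1 =>
    obtain ⟨p, u, u0, un, ub, uw, uc⟩ := ih1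
    obtain ⟨q, v, v0, vn, vb, vw, vc⟩ := ih2
    set w : ℤ → ℤ := fun x => if x ≤ p then u x else if x ≤ p + q then v (p + q - x) + 1
      else u (x - (p + q)) + 1 with hwdef
    push_cast at un ub
    have w1 : ∀ x : ℤ, 0 ≤ x → x ≤ p → w x = u x := fun x _ h => by simp [hwdef, h]
    have w2 : ∀ x : ℤ, p ≤ x → x ≤ p + q → w x = v (p + q - x) + 1 := by
      intro x h1 h2
      rcases h1.eq_or_lt with rfl | h1
      · simp only [hwdef, le_refl, if_true, add_sub_cancel_left]
        omega
      · simp only [hwdef, not_le.2 h1, h2, if_true, if_false]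
    have w3 : ∀ x : ℤ, p + q ≤ x → x ≤ p + q + p → w x = u (x - (p + q)) + 1 := by
      intro x h1 h2
      rcases h1.eq_or_lt with rfl | h1
      · rw [w2 _ (by omega) (by omega)]
        simp [v0, u0]
      · simp only [hwdef, not_le.2 h1, if_false]
        rw [if_neg (by omega)]
    have hw : IsWalkOn w 0 (p + q + p) := by
      intro i h1 h2
      rcases lt_or_ge i p with h | h
      · rw [w1 _ (by omega) (by omega), w1 _ (by omega) (by omega)]
        exact uw i h1 h
      rcases lt_or_ge i (p + q) with h' | h'
      · rw [w2 _ (by omega) (by omega), w2 _ (by omega) (by omega)]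
        have := vw (p + q - (i + 1)) (by omega) (by omega)
        rw [show (p + q - (i + 1) + 1 : ℤ) = p + q - i by ring] at this
        rw [abs_sub_comm]
        simpa using this
      · rw [w3 _ (by omega) (by omega), w3 _ (by omega) (by omega)]
        have := uw (i - (p + q)) (by omega) (by omega)
        rw [show (i + 1 - (p + q) : ℤ) = i - (p + q) + 1 by ring]
        simpa using this
    have b1 : ∀ x : ℤ, 0 ≤ x → x ≤ p → 0 ≤ w x ∧ w x ≤ n + 1 := fun x h1 h2 => by
      rw [w1 x h1 h2]; exact ub x h1 h2
    have b2 : ∀ x : ℤ, p ≤ x → x ≤ p + q → 1 ≤ w x ∧ w x ≤ n + 1 := fun x h1 h2 => by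
      rw [w2 x h1 h2]
      have := vb (p + q - x) (by omega) (by omega)
      omega
    have b3 : ∀ x : ℤ, p + q ≤ x → x ≤ p + q + p → 1 ≤ w x ∧ w x ≤ n + 2 := fun x h1 h2 => by
      rw [w3 x h1 h2]
      have := ub (x - (p + q)) (by omega) (by omega)
      omega
    have wp : w p = n + 1 := by rw [w1 _ (by omega) le_rfl, un]
    have wpq : w (p + q) = 1 := by rw [w2 _ (by omega) le_rfl]; simp [v0]
    have c1 : IsCrookedOn w 0 p := uc.congr w1
    have c2 : IsCrookedOn w p (p + q) := by
      have := (vc.comp_sub (p + q) 1)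
      simp only [add_sub_cancel_right, sub_zero] at this
      exact this.congr w2
    have c3 : IsCrookedOn w (p + q) (p + q + p) := by
      have := (uc.comp_add (p + q) 1)
      rw [zero_add, add_comm (p : ℤ) (p + q : ℤ)] at this
      exact this.congr w3
    have c12 : IsCrookedOn w 0 (p + q) := by
      refine IsCrookedOn.union 1 (Or.inl rfl) (hw.mono le_rfl (by omega)) c1 c2 fun i h1 h2 => ?_
      rcases le_total i p with h | h
      · have := b1 i h1 h; omega
      · have := b2 i h h2; omega
    have c23 : IsCrookedOn w p (p + q + p) := by
      refine IsCrookedOn.union (-1) (Or.inr rfl) (hw.mono (by omega) le_rfl) c2 c3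
        fun i h1 h2 => ?_
      rcases le_total i (p + q) with h | h
      · have := b2 i h1 h; omega
      · have := b3 i h h2; omega
    refine ⟨p + q + p, w, ?_, ?_, fun i h1 h2 => ?_, by exact_mod_cast hw, ?_⟩
    · rw [w1 _ le_rfl (by omega), u0]
    · push_cast
      rw [w3 _ (by omega) le_rfl]
      simp only [add_sub_cancel_left]
      omega
    · push_cast at h2 ⊢
      rcases le_total i p with h | h
      · have := b1 i h1 h; omega
      rcases le_total i (p + q) with h' | h'
      · have := b2 i h h'; omega
      · have := b3 i h' h2; omega
    · push_cast
      intro i j hi hij hj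
      by_cases hj' : j ≤ p + q
      · exact c12 i j hi hij hj'
      by_cases hi' : (p : ℤ) ≤ i
      · exact c23 i j hi' hij hj
      have B1 := b1 i hi (by omega)
      have B3 := b3 j (by omega) hj
      rcases le_total (w i) (w j) with hle | hle
      · -- the middle part descends from `n + 1` to `1`
        obtain ⟨k, hk1, hk2, hk3⟩ := (hw.mono (b' := p + q) (by omega : (0 : ℤ) ≤ p)
          (by omega)).exists_eq_of_ge (by omega) (v := min (w j) (n + 1)) (by omega) (by omega)
        obtain ⟨l, hl1, hl2, hl3⟩ := (hw.mono (b' := p + q) (by omega : (0 : ℤ) ≤ k)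
          (by omega)).exists_eq_of_ge (by omega) (v := max (w i) 1) (by omega) (by omega)
        exact ⟨k, l, by omega, hl1, by omega, abs_le.2 ⟨by omega, by omega⟩,
          abs_le.2 ⟨by omega, by omega⟩⟩
      · -- a part of the middle part descends from `w i` to `w j`
        obtain ⟨k, hk1, hk2, hk3⟩ := (hw.mono (b' := p + q) (by omega : (0 : ℤ) ≤ p)
          (by omega)).exists_eq_of_ge (by omega) (v := w i) (by omega) (by omega)
        obtain ⟨l, hl1, hl2, hl3⟩ := (hw.mono (b' := p + q) (by omega : (0 : ℤ) ≤ k)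
          (by omega)).exists_eq_of_ge (by omega) (v := w j) (by omega) (by omega)
        obtain ⟨s, t, h1, h2, h3, h4, h5⟩ := c2 k l hk1 hl1 hl2
        exact ⟨s, t, by omega, h2, by omega, by rwa [← hl3], by rwa [← hk3]⟩

/-- An inverse sequence of finite paths `{0, …, len k}` with crooked bonding maps. The bonding maps
contract (points at distance at most `6` go to points at distance at most `1`), which makes
"being equal or adjacent at every level" a transitive relation between threads. The form
`3 c + 5` of the lengths is convenient for covering the limit by chains. -/
structure CrookedSystem where
  /-- The number of the last link, when the path is cut into overlapping links `0, 1, …`. -/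
  chain : ℕ → ℕ
  /-- The last vertex of the path of level `k`. -/
  len : ℕ → ℤ
  /-- The bonding map from level `k + 1` to level `k`. -/
  bond : ℕ → ℤ → ℤ
  len_eq : ∀ k, len k = 3 * chain k + 5
  bond_mem : ∀ k s, s ∈ Icc 0 (len (k + 1)) → bond k s ∈ Icc 0 (len k)
  bond_contract : ∀ k s t, s ∈ Icc 0 (len (k + 1)) → t ∈ Icc 0 (len (k + 1)) → |s - t| ≤ 6 →
    |bond k s - bond k t| ≤ 1
  bond_surj : ∀ k, ∀ c ∈ Icc 0 (len k), ∃ s ∈ Icc 0 (len (k + 1)), bond k s = c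
  bond_crooked : ∀ k, IsCrookedOn (bond k) 0 (len (k + 1))

theorem CrookedSystem.nonempty : Nonempty CrookedSystem := by
  choose N w w0 wN wb ww wc using exists_crooked_walk
  obtain ⟨c, hc⟩ : ∃ c : ℕ → ℕ, ∀ k, c (k + 1) = 2 * N (3 * c k + 5) :=
    ⟨fun k => Nat.rec 0 (fun _ c => 2 * N (3 * c + 5)) k, fun _ => rfl⟩
  refine ⟨{
    chain := c
    len := fun k => 3 * c k + 5
    bond := fun k s => w (3 * c k + 5) (s / 6)
    len_eq := fun _ => rfl
    bond_mem := ?_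
    bond_contract := ?_
    bond_surj := ?_
    bond_crooked := ?_ }⟩
  · rintro k s ⟨h0, h1⟩
    rw [hc] at h1
    push_cast at h1
    exact_mod_cast wb (3 * c k + 5) (s / 6) (by omega) (by omega)
  · rintro k s t ⟨hs0, hs1⟩ ⟨ht0, ht1⟩ hst
    rw [hc] at hs1 ht1
    push_cast at hs1 ht1
    have := abs_le.1 hst
    rcases (by omega : s / 6 = t / 6 ∨ s / 6 = t / 6 + 1 ∨ t / 6 = s / 6 + 1) with h | h | h
    · simp [h]
    · simp only [h]
      exact ww _ _ (by omega) (by omega)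
    · simp only [h]
      rw [abs_sub_comm]
      exact ww _ _ (by omega) (by omega)
  · rintro k x ⟨h0, h1⟩
    obtain ⟨s, h2, h3, h4⟩ := (ww (3 * c k + 5)).exists_eq_of_le (by omega) (v := x)
      (by rw [w0]; exact h0) (by rw [wN]; exact_mod_cast h1)
    refine ⟨6 * s, ⟨by omega, ?_⟩, ?_⟩
    · rw [hc]
      push_cast
      omega
    · simp [h4]
  · intro k i j hi hij hj
    rw [hc] at hj
    push_cast at hj
    obtain ⟨p, q, h1, h2, h3, h4, h5⟩ := wc (3 * c k + 5) (i / 6) (j / 6) (by omega) (by omega)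
      (by omega)
    -- keep the endpoints inside `[i, j]` when rounding
    refine ⟨max i (min j (6 * p)), max i (min j (6 * q)), by omega, by omega, by omega, ?_, ?_⟩
    · dsimp only
      rwa [show max i (min j (6 * p)) / 6 = p by omega]
    · dsimp only
      rwa [show max i (min j (6 * q)) / 6 = q by omega]

/-! ### Threads -/

/-- The inverse limit of a crooked system, as a closed (totally disconnected) subspace of the
product of its finite levels. -/
def Thread (S : CrookedSystem) : Type :=
  {s : ℕ → ℤ // ∀ k, s k ∈ Icc 0 (S.len k) ∧ S.bond k (s (k + 1)) = s k}

namespace Thread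

variable {S : CrookedSystem}

instance : CoeFun (Thread S) fun _ => ℕ → ℤ := ⟨Subtype.val⟩

instance : TopologicalSpace (Thread S) := instTopologicalSpaceSubtype

theorem mem_Icc (s : Thread S) (k : ℕ) : s k ∈ Icc 0 (S.len k) := (s.2 k).1

theorem bond_eq (s : Thread S) (k : ℕ) : S.bond k (s (k + 1)) = s k := (s.2 k).2

theorem continuous_apply (k : ℕ) : Continuous fun s : Thread S => s k :=
  (_root_.continuous_apply k).comp continuous_subtype_val

instance : CompactSpace (Thread S) := by
  have hK : IsCompact (pi univ fun k => Icc (0 : ℤ) (S.len k)) :=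
    isCompact_univ_pi fun k => (finite_Icc _ _).isCompact
  suffices h : IsClosed {s : ℕ → ℤ | ∀ k, s k ∈ Icc 0 (S.len k) ∧ S.bond k (s (k + 1)) = s k} from
    isCompact_iff_compactSpace.1 (hK.of_isClosed_subset h fun s hs k _ => (hs k).1)
  have hcl : ∀ k, IsClosed {s : ℕ → ℤ | s k ∈ Icc 0 (S.len k) ∧ S.bond k (s (k + 1)) = s k} :=
    fun k => by
      have hb : Continuous (S.bond k) := continuous_of_discreteTopology
      exact ((isClosed_discrete (Icc 0 (S.len k))).preimage (_root_.continuous_apply k) :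
        IsClosed {s : ℕ → ℤ | s k ∈ Icc 0 (S.len k)}).and
        (isClosed_eq (by fun_prop) (by fun_prop))
  simpa only [ofPred_forall] using isClosed_iInter hcl

theorem abs_le_one_of_succ {s t : Thread S} {k : ℕ} (h : |s (k + 1) - t (k + 1)| ≤ 6) :
    |s k - t k| ≤ 1 := by
  rw [← s.bond_eq k, ← t.bond_eq k]
  exact S.bond_contract k _ _ (s.mem_Icc _) (t.mem_Icc _) h

theorem abs_le_one_of_le {s t : Thread S} {j k : ℕ} (hjk : j ≤ k) (h : |s k - t k| ≤ 1) :
    |s j - t j| ≤ 1 := by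
  induction k, hjk using Nat.le_induction with
  | base => exact h
  | succ k _ ih => exact ih (abs_le_one_of_succ (h.trans (by norm_num)))

theorem eq_of_le {s t : Thread S} {j k : ℕ} (hjk : j ≤ k) (h : s k = t k) : s j = t j := by
  induction k, hjk using Nat.le_induction with
  | base => exact h
  | succ k _ ih => exact ih (by rw [← s.bond_eq k, ← t.bond_eq k, h])

/-- Crookedness of the bonding maps, between two threads and in either direction. -/
theorem exists_crooked (s t : Thread S) (k : ℕ) :
    ∃ c d, |S.bond k c - t k| ≤ 1 ∧ |S.bond k d - s k| ≤ 1 ∧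
      (s (k + 1) ≤ c ∧ c ≤ d ∧ d ≤ t (k + 1) ∨ t (k + 1) ≤ d ∧ d ≤ c ∧ c ≤ s (k + 1)) := by
  rw [← s.bond_eq k, ← t.bond_eq k]
  rcases le_total (s (k + 1)) (t (k + 1)) with h | h
  · obtain ⟨c, d, h1, h2, h3, h4, h5⟩ := S.bond_crooked k _ _ (s.mem_Icc _).1 h (t.mem_Icc _).2
    exact ⟨c, d, h4, h5, Or.inl ⟨h1, h2, h3⟩⟩
  · obtain ⟨d, c, h1, h2, h3, h4, h5⟩ := S.bond_crooked k _ _ (t.mem_Icc _).1 h (s.mem_Icc _).2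
    exact ⟨c, d, h5, h4, Or.inr ⟨h1, h2, h3⟩⟩

theorem exists_apply_eq (k : ℕ) {c : ℤ} (hc : c ∈ Icc 0 (S.len k)) : ∃ s : Thread S, s k = c := by
  choose! up up_mem up_eq using S.bond_surj
  -- thread values below level `k`
  have down : ∀ n, ∀ c ∈ Icc 0 (S.len n), ∃ s : ℕ → ℤ, s n = c ∧ (∀ j ≤ n, s j ∈ Icc 0 (S.len j)) ∧
      ∀ j < n, S.bond j (s (j + 1)) = s j := by
    intro n
    induction n with
    | zero =>
      exact fun c hc => ⟨fun _ => c, rfl, fun j hj => by simpa [Nat.le_zero.1 hj] using hc,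
        fun j hj => absurd hj (Nat.not_lt_zero j)⟩
    | succ n ih =>
      intro c hc
      obtain ⟨s, h1, h2, h3⟩ := ih _ (S.bond_mem n c hc)
      refine ⟨Function.update s (n + 1) c, by simp, fun j hj => ?_, fun j hj => ?_⟩
      · rcases hj.eq_or_lt with rfl | hj
        · simpa using hc
        · rw [Function.update_of_ne hj.ne]
          exact h2 j (Nat.lt_succ_iff.1 hj)
      · rcases (Nat.lt_succ_iff.1 hj).eq_or_lt with rfl | hj'
        · rw [Function.update_self, Function.update_of_ne (by omega), h1]
        · rw [Function.update_of_ne (by omega), Function.update_of_ne (by omega)]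
          exact h3 j hj'
  obtain ⟨s, h1, h2, h3⟩ := down k c hc
  -- thread values above level `k`
  let u : ℕ → ℤ := fun j => Nat.rec c (fun i x => up (k + i) x) j
  have u_succ : ∀ j, u (j + 1) = up (k + j) (u j) := fun _ => rfl
  have hu : ∀ j, u j ∈ Icc 0 (S.len (k + j)) := by
    intro j
    induction j with
    | zero => exact hc
    | succ j ih => rw [u_succ]; exact up_mem _ _ ih
  refine ⟨⟨fun j => if j ≤ k then s j else u (j - k), fun j => ?_⟩, by simp [h1]⟩
  rcases lt_trichotomy j k with h | rfl | h
  · simp only [h.le, Nat.succ_le_of_lt h, if_true]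
    exact ⟨h2 j h.le, h3 j h⟩
  · simp only [le_refl, if_true, Nat.not_succ_le_self, if_false, h1, Nat.add_sub_cancel_left]
    exact ⟨hc, up_eq _ _ hc⟩
  · obtain ⟨i, rfl⟩ := Nat.exists_eq_add_of_lt h
    simp only [show ¬ k + i + 1 ≤ k by omega, show ¬ k + i + 1 + 1 ≤ k by omega, if_false,
      show k + i + 1 - k = i + 1 by omega, show k + i + 1 + 1 - k = i + 1 + 1 by omega]
    exact ⟨hu (i + 1), up_eq _ _ (hu (i + 1))⟩

/-- Equality or adjacency of threads at every level is a closed relation, and its neighbourhoods are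
described by single levels. -/
theorem exists_level_of_isOpen {ι : Type*} {O : Set ((ι → Thread S) × (ι → Thread S))}
    (hO : IsOpen O) (h : ∀ s t : ι → Thread S, (∀ i k, |s i k - t i k| ≤ 1) → (s, t) ∈ O) :
    ∃ n, ∀ s t : ι → Thread S, (∀ i, |s i n - t i n| ≤ 1) → (s, t) ∈ O := by
  let V : ℕ → Set ((ι → Thread S) × (ι → Thread S)) :=
    fun n => {p | ∀ i, |p.1 i n - p.2 i n| ≤ 1}
  have hcl : ∀ n, IsClosed (V n) := fun n => by
    simp only [V, ofPred_forall]
    refine isClosed_iInter fun i => ?_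
    have : Continuous fun p : (ι → Thread S) × (ι → Thread S) => |p.1 i n - p.2 i n| := by
      have h1 := (continuous_apply n).comp ((_root_.continuous_apply i).comp
        (continuous_fst (X := ι → Thread S) (Y := ι → Thread S)))
      have h2 := (continuous_apply n).comp ((_root_.continuous_apply i).comp
        (continuous_snd (X := ι → Thread S) (Y := ι → Thread S)))
      exact (h1.sub h2).abs
    exact isClosed_le this continuous_const
  obtain ⟨n, hn⟩ := exists_subset_nhds_of_isCompact' (V := V) (U := O)
    (directed_of_isDirected_le fun j k hjk p hp i => abs_le_one_of_le hjk (hp i))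
    (fun n => (hcl n).isCompact) hcl
    (fun p hp => hO.mem_nhds (h _ _ fun i k => mem_iInter.1 hp k i))
  exact ⟨n, fun s t hst => hn hst⟩

end Thread

/-! ### The cone over a power of the limit -/

/-- The gluing of `(ι → Thread S) × [0, 1]`. At heights `a ≥ 2⁻ᵏ` only the levels below `k` of the
threads matter, so the part of positive height is a tree whose branches are the threads; at height
`0` threads that are equal or adjacent at all levels are identified. -/
instance coneSetoid (S : CrookedSystem) (ι : Type) : Setoid ((ι → Thread S) × I) where
  r p q := p.2 = q.2 ∧ ∀ i k, (p.2 : ℝ) < (1 / 2) ^ k →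
    |p.1 i k - q.1 i k| ≤ 1 ∧ (0 < (p.2 : ℝ) → p.1 i k = q.1 i k)
  iseqv := by
    refine ⟨fun p => ⟨rfl, fun i k _ => by simp⟩, fun {p q} h => ⟨h.1.symm, fun i k hk => ?_⟩,
      fun {p q r} h h' => ⟨h.1.trans h'.1, fun i k hk => ?_⟩⟩
    · rw [← h.1] at hk ⊢
      exact ⟨abs_sub_comm (p.1 i k) _ ▸ (h.2 i k hk).1, fun h0 => ((h.2 i k hk).2 h0).symm⟩
    · have hk' := hk
      rw [h.1] at hk'
      rcases (p.2.2.1).eq_or_lt with h0 | h0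
      · refine ⟨Thread.abs_le_one_of_succ ?_, fun h => absurd h0 h.ne⟩
        have hpos : (p.2 : ℝ) < (1 / 2) ^ (k + 1) := by rw [← h0]; positivity
        have h1 := abs_le.1 (h.2 i (k + 1) hpos).1
        have h2 := abs_le.1 (h'.2 i (k + 1) (h.1 ▸ hpos)).1
        exact abs_le.2 ⟨by omega, by omega⟩
      · have h1 := (h.2 i k hk).2 h0
        have h2 := (h'.2 i k hk').2 (h.1 ▸ h0)
        rw [h1, h2]
        simp

/-- The space obtained by gluing `(ι → Thread S) × [0, 1]` along `coneSetoid`: a copy of the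
`ι`-th power of the pseudo-arc at height `0`, onto which a tree accumulates. -/
def Cone (S : CrookedSystem) (ι : Type) : Type := Quotient (coneSetoid S ι)

namespace Cone

variable {S : CrookedSystem} {ι : Type}

/-- The quotient map onto the cone. -/
def mk (p : (ι → Thread S) × I) : Cone S ι := Quotient.mk _ p

/-- The quotient map at height `0`. -/
def base (s : ι → Thread S) : Cone S ι := mk (s, 0)

instance instTopologicalSpaceCone : TopologicalSpace (Cone S ι) := instTopologicalSpaceQuotient

theorem isQuotientMap_mk : Topology.IsQuotientMap (mk : _ → Cone S ι) := isQuotientMap_quotient_mk'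

theorem continuous_mk : Continuous (mk : _ → Cone S ι) := isQuotientMap_mk.continuous

theorem mk_surjective : Function.Surjective (mk : _ → Cone S ι) := isQuotientMap_mk.surjective

theorem continuous_base : Continuous (base : _ → Cone S ι) :=
  continuous_mk.comp (by fun_prop)

instance : CompactSpace (Cone S ι) := Quotient.compactSpace

theorem mk_eq_mk {p q : (ι → Thread S) × I} : mk p = mk q ↔ p.2 = q.2 ∧
    ∀ i k, (p.2 : ℝ) < (1 / 2) ^ k →
      |p.1 i k - q.1 i k| ≤ 1 ∧ (0 < (p.2 : ℝ) → p.1 i k = q.1 i k) :=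
  Quotient.eq (r := coneSetoid S ι)

theorem base_eq_base {s t : ι → Thread S} :
    base s = base t ↔ ∀ i k, |s i k - t i k| ≤ 1 := by
  simp [base, mk_eq_mk]

/-- The height function on the cone. -/
def height : Cone S ι → ℝ := Quotient.lift (fun p => (p.2 : ℝ)) fun _ _ h => congrArg _ h.1

@[simp] theorem height_mk (p : (ι → Thread S) × I) : height (mk p) = p.2 := rfl

@[simp] theorem height_base (s : ι → Thread S) : height (base s) = 0 := rfl

theorem continuous_height : Continuous (height : Cone S ι → ℝ) :=
  isQuotientMap_mk.continuous_iff.2 (continuous_subtype_val.comp continuous_snd)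

theorem exists_base_eq {x : Cone S ι} (hx : height x = 0) : ∃ s, base s = x := by
  obtain ⟨⟨s, a⟩, rfl⟩ := mk_surjective x
  have ha : a = 0 := Subtype.ext hx
  exact ⟨s, by rw [ha]; rfl⟩

theorem continuous_level (i : ι) (k : ℕ) : Continuous fun p : (ι → Thread S) × I => p.1 i k :=
  (Thread.continuous_apply k).comp ((continuous_apply i).comp continuous_fst)

theorem isClosed_ker_mk :
    IsClosed {z : ((ι → Thread S) × I) × ((ι → Thread S) × I) | mk z.1 = mk z.2} := by
  simp only [mk_eq_mk, ofPred_and, ofPred_forall]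
  have hc : Continuous fun z : ((ι → Thread S) × I) × ((ι → Thread S) × I) => (z.1.2 : ℝ) := by
    fun_prop
  have hl1 := fun (i : ι) (k : ℕ) => (continuous_level (S := S) i k).comp
    (continuous_fst (X := (ι → Thread S) × I) (Y := (ι → Thread S) × I))
  have hl2 := fun (i : ι) (k : ℕ) => (continuous_level (S := S) i k).comp
    (continuous_snd (X := (ι → Thread S) × I) (Y := (ι → Thread S) × I))
  refine (isClosed_eq (by fun_prop) (by fun_prop)).inter
    (isClosed_iInter fun i => isClosed_iInter fun k => ?_)
  refine isClosed_imp (isOpen_lt hc continuous_const) (IsClosed.inter ?_ ?_)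
  · exact isClosed_le ((hl1 i k).sub (hl2 i k)).abs continuous_const
  · exact isClosed_imp (isOpen_lt continuous_const hc) (isClosed_eq (hl1 i k) (hl2 i k))

theorem isClosedMap_mk : IsClosedMap (mk : _ → Cone S ι) := by
  intro F hF
  rw [← isQuotientMap_mk.isClosed_preimage]
  have h := isClosedMap_snd_of_compactSpace _
    (isClosed_ker_mk.inter (hF.preimage continuous_fst) :
      IsClosed ({z : ((ι → Thread S) × I) × ((ι → Thread S) × I) | mk z.1 = mk z.2} ∩ _))
  convert h using 1
  ext q
  constructor
  · rintro ⟨p, hp, hpq⟩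
    exact ⟨(p, q), ⟨hpq, hp⟩, rfl⟩
  · rintro ⟨⟨p, q⟩, ⟨hpq, hp⟩, rfl⟩
    exact ⟨p, hp, hpq⟩

/-- An intermediate value theorem: below height `2⁻ᵏ`, the `k`-th level of a thread changes along a
connected set only at height `0`, and there only between adjacent values. -/
theorem exists_base_mem_of_lt {A : Set (Cone S ι)} (hA : IsPreconnected A) {i : ι} {k : ℕ}
    (hk : ∀ y ∈ A, height y < (1 / 2) ^ k) {p q : (ι → Thread S) × I} (hp : mk p ∈ A)
    (hq : mk q ∈ A) {w : ℤ} (h₁ : p.1 i k ≤ w) (h₂ : w < q.1 i k) :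
    ∃ s t : ι → Thread S, base s = base t ∧ base s ∈ A ∧ s i k = w ∧ t i k = w + 1 := by
  have hL : IsClosed {p : (ι → Thread S) × I | p.1 i k ≤ w} :=
    isClosed_le (continuous_level i k) continuous_const
  have hG : IsClosed {p : (ι → Thread S) × I | w + 1 ≤ p.1 i k} :=
    isClosed_le continuous_const (continuous_level i k)
  obtain ⟨y, hyA, ⟨⟨s, a⟩, hs, rfl⟩, ⟨⟨t, b⟩, ht, hst⟩⟩ :=
    isPreconnected_closed_iff.1 hA _ _ (isClosedMap_mk _ hL) (isClosedMap_mk _ hG)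
      (fun y _ => by
        obtain ⟨r, rfl⟩ := mk_surjective y
        rcases le_or_gt (r.1 i k) w with h | h
        · exact Or.inl ⟨r, h, rfl⟩
        · exact Or.inr ⟨r, h, rfl⟩)
      ⟨_, hp, p, h₁, rfl⟩ ⟨_, hq, q, h₂, rfl⟩
  obtain ⟨rfl, hst'⟩ := mk_eq_mk.1 hst.symm
  have h := hst' i k (hk _ hyA)
  simp only [mem_ofPred_eq] at hs ht h
  have h1 := abs_le.1 h.1
  have ha : a = 0 := by
    by_contra ha
    have := h.2 (lt_of_le_of_ne a.2.1 fun h => ha (Subtype.ext h.symm))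
    omega
  subst ha
  exact ⟨s, t, hst.symm, hyA, by omega, by omega⟩

theorem exists_base_mem {A : Set (Cone S ι)} (hA : IsPreconnected A) {i : ι} {k : ℕ}
    (hk : ∀ y ∈ A, height y < (1 / 2) ^ k) {s t : ι → Thread S} (hs : base s ∈ A)
    (ht : base t ∈ A) {w : ℤ} (hw : s i k ≤ w ∧ w ≤ t i k ∨ t i k ≤ w ∧ w ≤ s i k) :
    ∃ r : ι → Thread S, base r ∈ A ∧ r i k = w := by
  wlog hst : s i k ≤ w ∧ w ≤ t i k generalizing s t with H
  · exact H ht hs hw.symm (hw.resolve_left hst)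
  rcases hst.2.eq_or_lt with h | h
  · exact ⟨t, ht, h.symm⟩
  · obtain ⟨r, _, _, h1, h2, _⟩ := exists_base_mem_of_lt hA hk hs ht hst.1 h
    exact ⟨r, h1, h2⟩

end Cone

/-! ### The length metric induced by a real function -/

section PathEDist

variable {Y : Type*} [TopologicalSpace Y]

/-- The infimum of the variations of `h` along the paths from `x` to `y`. -/
noncomputable def pathEDist (h : Y → ℝ) (x y : Y) : ENNReal :=
  ⨅ γ : Path x y, eVariationOn (h ∘ γ) univ

theorem pathEDist_self (h : Y → ℝ) (x : Y) : pathEDist h x x = 0 :=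
  nonpos_iff_eq_zero.1 <| (iInf_le _ (Path.refl x)).trans <| le_of_eq <|
    eVariationOn.constant_on (by rintro _ ⟨s, _, rfl⟩ _ ⟨t, _, rfl⟩; rfl)

theorem pathEDist_le_symm (h : Y → ℝ) (x y : Y) : pathEDist h x y ≤ pathEDist h y x :=
  le_iInf fun γ => (iInf_le _ γ.symm).trans <|
    eVariationOn.comp_le_of_antitoneOn (h ∘ γ) unitInterval.symm
      (fun _ _ _ _ hst => unitInterval.symm_le_symm.2 hst) (mapsTo_univ _ _)

theorem pathEDist_comm (h : Y → ℝ) (x y : Y) : pathEDist h x y = pathEDist h y x :=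
  (pathEDist_le_symm h x y).antisymm (pathEDist_le_symm h y x)

theorem eVariationOn_trans_le (h : Y → ℝ) {x y z : Y} (γ : Path x y) (δ : Path y z) :
    eVariationOn (h ∘ γ.trans δ) univ ≤ eVariationOn (h ∘ γ) univ + eVariationOn (h ∘ δ) univ := by
  let c : I := ⟨1 / 2, by norm_num, by norm_num⟩
  have hc := eVariationOn.union (h ∘ γ.trans δ) (x := c) isGreatest_Iic isLeast_Ici
  rw [Iic_union_Ici] at hc
  rw [hc]
  refine add_le_add ?_ ?_
  · have e : EqOn (h ∘ γ.trans δ) ((h ∘ γ) ∘ fun t => projIcc (0 : ℝ) 1 zero_le_one (2 * (t : ℝ)))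
        (Iic c) := fun t ht => by
      have ht' : (t : ℝ) ≤ 1 / 2 := ht
      have hmem : 2 * (t : ℝ) ∈ I := ⟨by linarith [t.2.1], by linarith⟩
      simp only [Function.comp_apply, Path.trans_apply, ht', dite_true, projIcc_of_mem _ hmem]
    rw [eVariationOn.congr e]
    exact eVariationOn.comp_le_of_monotoneOn _ _
      (fun s _ t _ hst => monotone_projIcc _ (mul_le_mul_of_nonneg_left hst zero_le_two))
      (mapsTo_univ _ _)
  · have e : EqOn (h ∘ γ.trans δ) ((h ∘ δ) ∘ fun t => projIcc (0 : ℝ) 1 zero_le_one (2 * (t : ℝ) - 1))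
        (Ici c) := fun t ht => by
      have ht' : 1 / 2 ≤ (t : ℝ) := ht
      have hmem : 2 * (t : ℝ) - 1 ∈ I := ⟨by linarith, by linarith [t.2.2]⟩
      simp only [Function.comp_apply, Path.trans_apply, projIcc_of_mem _ hmem]
      split_ifs with h1
      · obtain rfl : t = c := Subtype.ext (le_antisymm h1 ht')
        simp [c]
      · rfl
    rw [eVariationOn.congr e]
    exact eVariationOn.comp_le_of_monotoneOn _ _
      (fun s _ t _ hst => monotone_projIcc _ (by
        have hst' : (s : ℝ) ≤ t := hst
        linarith)) (mapsTo_univ _ _)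

theorem pathEDist_triangle (h : Y → ℝ) (x y z : Y) :
    pathEDist h x z ≤ pathEDist h x y + pathEDist h y z :=
  ENNReal.le_iInf_add_iInf fun γ δ => (iInf_le _ (γ.trans δ)).trans (eVariationOn_trans_le h γ δ)

theorem edist_le_pathEDist (h : Y → ℝ) (x y : Y) : edist (h x) (h y) ≤ pathEDist h x y :=
  le_iInf fun γ => by
    have := eVariationOn.edist_le (h ∘ γ) (mem_univ 0) (mem_univ 1)
    simpa using this

theorem pathEDist_le_eVariationOn (h : Y → ℝ) (γ : C(I, Y)) {s t : I} (hst : s ≤ t) :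
    pathEDist h (γ s) (γ t) ≤ eVariationOn (h ∘ γ) (Icc s t) := by
  let δ : Path (γ s) (γ t) :=
    { toFun := γ ∘ Icc.convexComb s t
      source' := by simp
      target' := by simp }
  refine (iInf_le _ δ).trans
    (eVariationOn.comp_le_of_monotoneOn (h ∘ γ) (Icc.convexComb s t) ?_ ?_)
  · intro u _ v _ huv
    have h1 : (s : ℝ) ≤ t := hst
    have h2 : (u : ℝ) ≤ v := huv
    refine Subtype.coe_le_coe.1 ?_
    simp only [Icc.coe_convexComb]
    nlinarith
  · intro u _
    have h1 : (s : ℝ) ≤ t := hst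
    have h2 := u.2.1
    have h3 := u.2.2
    constructor <;> refine Subtype.coe_le_coe.1 ?_ <;> simp only [Icc.coe_convexComb] <;> nlinarith

end PathEDist

theorem eq_of_le_of_compactSpace_of_t2Space {X : Type*} {t₁ t₂ : TopologicalSpace X} (hle : t₁ ≤ t₂)
    (hc : @CompactSpace X t₁) (h₂ : @T2Space X t₂) : t₁ = t₂ := by
  have h := @Continuous.isClosedEmbedding X X t₁ t₂ hc h₂ id (continuous_id_iff_le.2 hle)
    Function.injective_id
  exact (@Topology.IsInducing.eq_induced X X t₁ t₂ id
    (@Topology.IsEmbedding.toIsInducing X X t₁ t₂ id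
      (@Topology.IsClosedEmbedding.toIsEmbedding X X t₁ t₂ id h))).trans induced_id

theorem continuous_of_edist_lt {T E : Type*} [TopologicalSpace T] [PseudoEMetricSpace E] {f : T → E}
    (h : ∀ x, ∀ ε > 0, ∀ᶠ y in nhds x, edist (f y) (f x) < ε) : Continuous f :=
  continuous_iff_continuousAt.2 fun x => EMetric.tendsto_nhds.2 (h x)

namespace Cone

variable {S : CrookedSystem} {ι : Type}

theorem pathEDist_vertical_le (s : ι → Thread S) {a b : I} (hab : a ≤ b) :
    pathEDist height (mk (s, a)) (mk (s, b)) ≤ ENNReal.ofReal (b - a) := by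
  let γ : C(I, Cone S ι) := ⟨fun u => mk (s, u), continuous_mk.comp (by fun_prop)⟩
  refine (pathEDist_le_eVariationOn height γ hab).trans_eq ?_
  have h : MonotoneOn (height ∘ γ) univ := fun u _ v _ huv => huv
  have h' := h.eVariationOn_eq (mem_univ a) (mem_univ b)
  rwa [univ_inter] at h'

theorem pathEDist_le_of_mk_eq {s t : ι → Thread S} {a b c : I} (hac : a ≤ c) (hbc : b ≤ c)
    (h : mk (s, c) = mk (t, c)) :
    pathEDist height (mk (s, a)) (mk (t, b)) ≤ ENNReal.ofReal ((c - a) + (c - b)) := by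
  rw [ENNReal.ofReal_add (sub_nonneg.2 hac) (sub_nonneg.2 hbc)]
  refine (pathEDist_triangle height _ (mk (s, c)) _).trans
    (add_le_add (pathEDist_vertical_le s hac) ?_)
  rw [pathEDist_comm, h]
  exact pathEDist_vertical_le t hbc

theorem pathEDist_ne_top (x y : Cone S ι) : pathEDist height x y ≠ ⊤ := by
  obtain ⟨⟨s, a⟩, rfl⟩ := mk_surjective x
  obtain ⟨⟨t, b⟩, rfl⟩ := mk_surjective y
  refine ne_top_of_le_ne_top ENNReal.ofReal_ne_top
    (pathEDist_le_of_mk_eq (s := s) (t := t) (c := 1) unitInterval.le_one' unitInterval.le_one'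
      (mk_eq_mk.2 ⟨rfl, fun i k hk => ?_⟩))
  exact absurd hk (not_lt.2 (pow_le_one₀ (by norm_num) (by norm_num)))

theorem pathEDist_le_of_level_eq {s t : ι → Thread S} {a b : I} {k : ℕ}
    (h : ∀ i, s i k = t i k) : pathEDist height (mk (s, a)) (mk (t, b)) ≤
      ENNReal.ofReal (2 * |(a : ℝ) - b| + 2 * (1 / 2) ^ (k + 1)) := by
  have hpos : (0 : ℝ) ≤ (1 / 2) ^ (k + 1) := by positivity
  let c : I := ⟨max (max a b) ((1 / 2) ^ (k + 1)), le_max_of_le_right hpos,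
    max_le (max_le a.2.2 b.2.2) (pow_le_one₀ (by norm_num) (by norm_num))⟩
  have hac : (a : ℝ) ≤ c := (le_max_left _ _).trans (le_max_left _ _)
  have hbc : (b : ℝ) ≤ c := (le_max_right _ _).trans (le_max_left _ _)
  refine (pathEDist_le_of_mk_eq (s := s) (t := t) (c := c) hac hbc (mk_eq_mk.2 ⟨rfl, fun i j hj => ?_⟩)).trans
    (ENNReal.ofReal_le_ofReal ?_)
  · have hjk : j ≤ k := by
      have h1 : ((1 : ℝ) / 2) ^ (k + 1) < (1 / 2) ^ j := (le_max_right _ _).trans_lt hj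
      have := (pow_lt_pow_iff_right_of_lt_one₀ (by norm_num) (by norm_num)).1 h1
      omega
    have := Thread.eq_of_le hjk (h i)
    exact ⟨by simp [this], fun _ => this⟩
  · have h1 : (c : ℝ) ≤ max (a : ℝ) b + (1 / 2) ^ (k + 1) :=
      max_le (by linarith) (by have := a.2.1; have := le_max_left (a : ℝ) b; linarith)
    have h2 : max (a : ℝ) b - a ≤ |(a : ℝ) - b| := by
      rw [max_def]; split_ifs with h
      · rw [abs_sub_comm]; exact le_abs_self _
      · simp
    have h3 : max (a : ℝ) b - b ≤ |(a : ℝ) - b| := by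
      rw [max_def]; split_ifs with h
      · simp
      · exact le_abs_self _
    linarith

/-! ### Crookedness separates points -/

/-- All threads passing within `2` of `s` at level `k` pass within `2` of `a` at level `n`. -/
def IsNear (n k : ℕ) (s : Thread S) (a : ℤ) : Prop :=
  ∀ r : Thread S, |r k - s k| ≤ 2 → |r n - a| ≤ 2

theorem IsNear.succ {n k : ℕ} {s t : Thread S} {a : ℤ} (h : IsNear n k s a)
    (hst : |t k - s k| ≤ 1) : IsNear n (k + 1) t a := fun r hr => by
  have h1 := abs_le.1 (Thread.abs_le_one_of_succ (hr.trans (by norm_num)))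
  have h2 := abs_le.1 hst
  exact h r (abs_le.2 ⟨by omega, by omega⟩)

theorem IsNear.abs_le {n k : ℕ} {s : Thread S} {a : ℤ} (h : IsNear n k s a) : |s n - a| ≤ 2 :=
  h s (by simp)

/-- One of three consecutive intervals has at most half of the total length and less than half of
a bound for the total variation. -/
theorem exists_half_of_three {E : Type*} [PseudoEMetricSpace E] (f : I → E) {x₀ x₁ x₂ x₃ : I}
    (h₀ : x₀ ≤ x₁) (h₁ : x₁ ≤ x₂) (h₂ : x₂ ≤ x₃) {V : ENNReal} {δ : ℝ}
    (hV : eVariationOn f (Icc x₀ x₃) < V + V) (hδ : (x₃ : ℝ) - x₀ ≤ δ + δ) :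
    (eVariationOn f (Icc x₀ x₁) < V ∧ (x₁ : ℝ) - x₀ ≤ δ) ∨
    (eVariationOn f (Icc x₁ x₂) < V ∧ (x₂ : ℝ) - x₁ ≤ δ) ∨
    (eVariationOn f (Icc x₂ x₃) < V ∧ (x₃ : ℝ) - x₂ ≤ δ) := by
  have hsum : eVariationOn f (Icc x₀ x₁) + eVariationOn f (Icc x₁ x₂) +
      eVariationOn f (Icc x₂ x₃) < V + V := by
    have e1 := eVariationOn.Icc_add_Icc f (s := univ) h₀ h₁ (mem_univ _)
    have e2 := eVariationOn.Icc_add_Icc f (s := univ) (h₀.trans h₁) h₂ (mem_univ _)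
    simp only [univ_inter] at e1 e2
    rwa [e1, e2]
  have l0 : (x₀ : ℝ) ≤ x₁ := h₀
  have l1 : (x₁ : ℝ) ≤ x₂ := h₁
  have l2 : (x₂ : ℝ) ≤ x₃ := h₂
  by_contra hcon
  simp only [not_or, not_and_or, not_lt, not_le] at hcon
  obtain ⟨c0, c1, c2⟩ := hcon
  have key : ∀ {u v w : ENNReal}, V ≤ u → V ≤ v → u + v ≤ w → w < V + V → False :=
    fun hu hv huv hw => absurd ((add_le_add hu hv).trans huv) (not_le.2 hw)
  rcases c0 with c0 | c0 <;> rcases c1 with c1 | c1 <;> rcases c2 with c2 | c2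
  · exact key c0 c1 le_self_add hsum
  · exact key c0 c1 le_self_add hsum
  · exact key c0 c2 (by gcongr; exact le_self_add) hsum
  · linarith
  · exact key c1 c2 (by gcongr; exact le_add_self) hsum
  · linarith
  · linarith
  · linarith

/-- A path joining two points at height `0` whose `n`-th levels differ by at least `6` has height
variation at least `2⁻⁽ⁿ⁺¹⁾`. Indeed, crookedness of the bonding map makes every path of variation
less than `2⁻⁽ᵏ⁺¹⁾` that traverses level `k` from near `a` to near `b` run from `a` to `b`, back to
`a`, and again to `b`; one of these three subpaths has half the variation and is defined on an
interval of half the length, so it can be treated in the same way at level `k + 1`. Hence the path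
oscillates between `a` and `b` on arbitrarily short intervals. -/
theorem le_eVariationOn_height (γ : C(I, Cone S ι)) {s t : ι → Thread S} (hs : base s = γ 0)
    (ht : base t = γ 1) {i : ι} {n : ℕ} (hst : 6 ≤ |s i n - t i n|) :
    ENNReal.ofReal ((1 / 2) ^ (n + 1)) ≤ eVariationOn (height ∘ γ) univ := by
  by_contra! hlt
  set a := s i n
  set b := t i n
  have claim : ∀ j : ℕ, ∃ x y : I, x ≤ y ∧ (y : ℝ) - x ≤ (1 / 2) ^ j ∧
      eVariationOn (height ∘ γ) (Icc x y) < ENNReal.ofReal ((1 / 2) ^ (n + j + 1)) ∧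
      ∃ p q : ι → Thread S, base p = γ x ∧ base q = γ y ∧
        (IsNear n (n + j) (p i) a ∧ IsNear n (n + j) (q i) b ∨
          IsNear n (n + j) (p i) b ∧ IsNear n (n + j) (q i) a) := by
    intro j
    induction j with
    | zero =>
      exact ⟨0, 1, zero_le_one, by simp, (eVariationOn.mono _ (subset_univ _)).trans_lt hlt, s, t,
        hs, ht, Or.inl ⟨fun r hr => hr, fun r hr => hr⟩⟩
    | succ j ih =>
      obtain ⟨x, y, hxy, hlen, hvar, p, q, hp, hq, hpq⟩ := ih
      set k := n + j
      have hlow : ∀ z ∈ Icc x y, height (γ z) < (1 / 2) ^ (k + 1) := by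
        intro z hz
        have h1 := (eVariationOn.edist_le (height ∘ γ) hz (left_mem_Icc.2 hxy)).trans_lt hvar
        rw [edist_dist, ENNReal.ofReal_lt_ofReal_iff (by positivity)] at h1
        simp only [Function.comp_apply, ← hp, height_base, Real.dist_eq, sub_zero] at h1
        exact (le_abs_self _).trans_lt h1
      obtain ⟨c, d, hc, hd, hcd⟩ := (p i).exists_crooked (q i) k
      have hconn : ∀ u v : I, IsPreconnected (γ '' Icc u v) := fun u v =>
        isPreconnected_Icc.image _ γ.continuous.continuousOn
      have hmem : ∀ {u v z : I} {r : ι → Thread S}, base r = γ z → z ∈ Icc u v →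
          base r ∈ γ '' Icc u v := fun hr hz => ⟨_, hz, hr.symm⟩
      obtain ⟨r, ⟨z, hz, hzr⟩, hr⟩ := exists_base_mem (hconn x y) (i := i) (k := k + 1)
        (forall_mem_image.2 hlow) (hmem hp (left_mem_Icc.2 hxy))
        (hmem hq (right_mem_Icc.2 hxy)) (w := c) (by omega)
      obtain ⟨r', ⟨z', hz', hzr'⟩, hr'⟩ := exists_base_mem (hconn z y) (i := i) (k := k + 1)
        (forall_mem_image.2 fun u hu => hlow u ⟨hz.1.trans hu.1, hu.2⟩)
        (hmem hzr.symm (left_mem_Icc.2 hz.2)) (hmem hq (right_mem_Icc.2 hz.2)) (w := d) (by omega)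
      have nr : |r i k - q i k| ≤ 1 := by rwa [← (r i).bond_eq k, hr]
      have nr' : |r' i k - p i k| ≤ 1 := by rwa [← (r' i).bond_eq k, hr']
      have np : |p i k - p i k| ≤ 1 := by simp
      have nq : |q i k - q i k| ≤ 1 := by simp
      have hV : eVariationOn (height ∘ γ) (Icc x y) <
          ENNReal.ofReal ((1 / 2) ^ (k + 1 + 1)) + ENNReal.ofReal ((1 / 2) ^ (k + 1 + 1)) := by
        rw [← ENNReal.ofReal_add (by positivity) (by positivity), pow_succ _ (k + 1)]
        refine hvar.trans_eq (congrArg _ ?_)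
        ring
      have hδ : (y : ℝ) - x ≤ (1 / 2) ^ (j + 1) + (1 / 2) ^ (j + 1) := by
        rw [pow_succ]; linarith
      rcases exists_half_of_three _ hz.1 hz'.1 hz'.2 hV hδ with ⟨h1, h2⟩ | ⟨h1, h2⟩ | ⟨h1, h2⟩
      · refine ⟨x, z, hz.1, h2, h1, p, r, hp, hzr.symm, ?_⟩
        exact hpq.imp (fun h => ⟨h.1.succ np, h.2.succ nr⟩) (fun h => ⟨h.1.succ np, h.2.succ nr⟩)
      · refine ⟨z, z', hz'.1, h2, h1, r, r', hzr.symm, hzr'.symm, ?_⟩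
        exact hpq.symm.imp (fun h => ⟨h.2.succ nr, h.1.succ nr'⟩)
          (fun h => ⟨h.2.succ nr, h.1.succ nr'⟩)
      · refine ⟨z', y, hz'.2, h2, h1, r', q, hzr'.symm, hq, ?_⟩
        exact hpq.imp (fun h => ⟨h.1.succ nr', h.2.succ nq⟩)
          (fun h => ⟨h.1.succ nr', h.2.succ nq⟩)
  -- the times at which the path passes near `c` at level `n`
  let F : ℤ → Set I := fun c => γ ⁻¹' (mk '' {p : (ι → Thread S) × I | |p.1 i n - c| ≤ 2 ∧ p.2 = 0})
  have hF : ∀ c, IsClosed (F c) := fun c => by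
    have h1 : IsClosed {p : (ι → Thread S) × I | |p.1 i n - c| ≤ 2} :=
      isClosed_le ((continuous_level i n).sub continuous_const).abs continuous_const
    have h2 : IsClosed {p : (ι → Thread S) × I | p.2 = 0} :=
      isClosed_eq continuous_snd continuous_const
    exact (isClosedMap_mk _ (h1.and h2)).preimage γ.continuous
  have hFmem : ∀ {c : ℤ} {p : ι → Thread S} {x : I}, base p = γ x → |p i n - c| ≤ 2 → x ∈ F c :=
    fun hx hp => ⟨(_, 0), ⟨hp, rfl⟩, hx⟩
  have hdisj : Disjoint (F a) (F b) := by
    rw [disjoint_left]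
    rintro x ⟨⟨p, u⟩, ⟨hp, hu⟩, hpx⟩ ⟨⟨q, v⟩, ⟨hq, hv⟩, hqx⟩
    obtain rfl : u = 0 := hu
    obtain rfl : v = 0 := hv
    have h1 := abs_le.1 (base_eq_base.1 (hpx.trans hqx.symm) i n)
    have h2 := abs_le.1 hp
    have h3 := abs_le.1 hq
    dsimp only at h2 h3
    rcases le_abs.1 hst with h | h <;> omega
  obtain ⟨δ, hδ, hthick⟩ := hdisj.exists_thickenings (hF a).isCompact (hF b)
  obtain ⟨j, hj⟩ := exists_pow_lt_of_lt_one hδ (by norm_num : (1 / 2 : ℝ) < 1)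
  obtain ⟨x, y, hxy, hlen, -, p, q, hp, hq, hpq⟩ := claim j
  have hdist : dist x y < δ := by
    have hxy' : (x : ℝ) ≤ y := hxy
    rw [dist_comm, Subtype.dist_eq, Real.dist_eq, abs_of_nonneg (sub_nonneg.2 hxy')]
    exact hlen.trans_lt hj
  rcases hpq with ⟨h1, h2⟩ | ⟨h1, h2⟩
  · exact disjoint_left.1 hthick (Metric.self_subset_thickening hδ _ (hFmem hp h1.abs_le))
      (Metric.mem_thickening_iff.2 ⟨y, hFmem hq h2.abs_le, hdist⟩)
  · exact disjoint_left.1 hthick (Metric.self_subset_thickening hδ _ (hFmem hq h2.abs_le))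
      (Metric.mem_thickening_iff.2 ⟨x, hFmem hp h1.abs_le, by rwa [dist_comm]⟩)

theorem eq_of_pathEDist_eq_zero {x y : Cone S ι} (h : pathEDist height x y = 0) : x = y := by
  have exists_path : ∀ ε : ℝ, 0 < ε → ∃ γ : Path x y,
      eVariationOn (height ∘ γ) univ < ENNReal.ofReal ε := fun ε hε =>
    iInf_lt_iff.1 (h.trans_lt (ENNReal.ofReal_pos.2 hε))
  have hxy : height x = height y := edist_eq_zero.1
    (nonpos_iff_eq_zero.1 ((edist_le_pathEDist height x y).trans h.le))
  obtain ⟨⟨s, a⟩, rfl⟩ := mk_surjective x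
  obtain ⟨⟨t, b⟩, rfl⟩ := mk_surjective y
  obtain rfl : a = b := Subtype.ext hxy
  refine mk_eq_mk.2 ⟨rfl, fun i k hk => ?_⟩
  dsimp only at hk ⊢
  rcases (a.2.1).eq_or_lt with ha | ha
  · refine ⟨?_, fun h => absurd ha h.ne⟩
    obtain rfl : a = 0 := Subtype.ext ha.symm
    by_contra hcon
    obtain ⟨γ, hγ⟩ := exists_path ((1 / 2) ^ (k + 1 + 1)) (by positivity)
    refine absurd (le_eVariationOn_height γ.toContinuousMap (s := s) (t := t) (i := i) (n := k + 1)
      γ.source.symm γ.target.symm ?_) (not_le.2 hγ)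
    by_contra h6
    exact hcon (Thread.abs_le_one_of_succ (by omega))
  · suffices heq : s i k = t i k from ⟨by simp [heq], fun _ => heq⟩
    obtain ⟨γ, hγ⟩ := exists_path (min (a : ℝ) ((1 / 2) ^ k - a)) (lt_min ha (sub_pos.2 hk))
    have hrange : ∀ z ∈ range γ, 0 < height z ∧ height z < (1 / 2) ^ k := by
      rintro _ ⟨u, rfl⟩
      have h1 := (eVariationOn.edist_le (height ∘ γ) (mem_univ u) (mem_univ 0)).trans_lt hγ
      rw [edist_dist, ENNReal.ofReal_lt_ofReal_iff (lt_min ha (sub_pos.2 hk))] at h1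
      simp only [Function.comp_apply, γ.source, height_mk, Real.dist_eq] at h1
      have h2 := abs_lt.1 h1
      have h3 := min_le_left (a : ℝ) ((1 / 2) ^ k - a)
      have h4 := min_le_right (a : ℝ) ((1 / 2) ^ k - a)
      constructor <;> linarith
    have hconn : IsPreconnected (range γ) := isPreconnected_range γ.continuous
    have hs : mk (s, a) ∈ range γ := ⟨0, γ.source⟩
    have ht : mk (t, a) ∈ range γ := ⟨1, γ.target⟩
    rcases lt_trichotomy (s i k) (t i k) with hlt | heq | hlt
    · obtain ⟨p, _, _, hp, _⟩ := exists_base_mem_of_lt hconn (fun z hz => (hrange z hz).2) hs ht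
        (w := s i k) le_rfl hlt
      exact absurd (hrange _ hp).1 (lt_irrefl _)
    · exact heq
    · obtain ⟨p, _, _, hp, _⟩ := exists_base_mem_of_lt hconn (fun z hz => (hrange z hz).2) ht hs
        (w := t i k) le_rfl hlt
      exact absurd (hrange _ hp).1 (lt_irrefl _)

/-! ### The cone as a metric space -/

/-- The cone with the extended distance `pathEDist height`. Its topology is the quotient
topology by `topology_eq`. -/
noncomputable abbrev emetricSpace (S : CrookedSystem) (ι : Type) : EMetricSpace (Cone S ι) where
  edist := pathEDist height
  edist_self := pathEDist_self height
  edist_comm := pathEDist_comm height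
  edist_triangle := pathEDist_triangle height
  eq_of_edist_eq_zero := eq_of_pathEDist_eq_zero

theorem topology_eq [Finite ι] : (instTopologicalSpaceCone : TopologicalSpace (Cone S ι)) =
    (emetricSpace S ι).toUniformSpace.toTopologicalSpace := by
  have hlim : ∀ p : (ι → Thread S) × I, ∀ ε > 0, ∀ᶠ q in nhds p,
      pathEDist height (mk q) (mk p) < ε := by
    rintro ⟨s, a⟩ ε hε
    obtain ⟨ε', hε', hlt⟩ := ENNReal.lt_iff_exists_real_btwn.1 hε
    have hε'0 : 0 < ε' := ENNReal.ofReal_pos.1 hlt.1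
    obtain ⟨k, hk⟩ := exists_pow_lt_of_lt_one (by positivity : (0 : ℝ) < ε' / 4)
      (by norm_num : (1 / 2 : ℝ) < 1)
    have h1 : ∀ᶠ q : (ι → Thread S) × I in nhds (s, a), ∀ i, q.1 i k = s i k :=
      Filter.eventually_all.2 fun i =>
        (continuous_level i k).continuousAt.preimage_mem_nhds
          ((isOpen_discrete {s i k}).mem_nhds (mem_singleton _))
    have h2 : ∀ᶠ q : (ι → Thread S) × I in nhds (s, a), |(q.2 : ℝ) - a| < ε' / 4 :=
      (by fun_prop : Continuous fun q : (ι → Thread S) × I => |(q.2 : ℝ) - a|).continuousAt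
        |>.eventually_lt continuousAt_const (by simpa using by positivity)
    filter_upwards [h1, h2] with ⟨t, b⟩ h1 h2
    refine (pathEDist_le_of_level_eq h1).trans_lt
      ((ENNReal.ofReal_le_ofReal ?_).trans_lt hlt.2)
    rw [pow_succ]
    dsimp only at h2
    linarith
  have hcont : @Continuous _ (Cone S ι) _ (emetricSpace S ι).toUniformSpace.toTopologicalSpace
      mk := @continuous_of_edist_lt _ _ _ (emetricSpace S ι).toPseudoEMetricSpace _ hlim
  have hle : instTopologicalSpaceCone ≤ (emetricSpace S ι).toUniformSpace.toTopologicalSpace := by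
    rw [isQuotientMap_mk.eq_coinduced]
    exact continuous_iff_coinduced_le.1 hcont
  have hT2 : @T2Space (Cone S ι) (emetricSpace S ι).toUniformSpace.toTopologicalSpace := by
    let := emetricSpace S ι
    infer_instance
  exact eq_of_le_of_compactSpace_of_t2Space hle inferInstance hT2

noncomputable instance [Finite ι] : MetricSpace (Cone S ι) :=
  ((emetricSpace S ι).toMetricSpace pathEDist_ne_top).replaceTopology topology_eq

theorem isPathIsometry_height [Finite ι] : IsPathIsometry (height : Cone S ι → ℝ) := by
  intro γ
  refine le_antisymm (iSup_le fun p => ?_) (iSup_mono fun p => Finset.sum_le_sum fun i _ =>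
    edist_le_pathEDist height _ _)
  obtain ⟨n, u, hu, -⟩ := p
  refine (Finset.sum_le_sum fun i _ => ?_).trans
    ((eVariationOn.sum' (height ∘ γ) hu).le.trans (eVariationOn.mono _ (subset_univ _)))
  rw [edist_comm]
  exact pathEDist_le_eVariationOn height γ (hu i.le_succ)

theorem isLengthSpace [Finite ι] : IsLengthSpace (Cone S ι) := fun _ _ =>
  iInf_congr fun γ => (isPathIsometry_height γ.toContinuousMap).symm

end Cone

namespace Cone

variable {S : CrookedSystem} {ι : Type}

/-! ### The fibre at height zero -/

/-- The fibre of the height function over `0`. -/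
abbrev fiber (S : CrookedSystem) (ι : Type) : Set (Cone S ι) := height ⁻¹' {0}

/-- The projection of families of threads onto the fibre at height `0`. -/
def toFiber (s : ι → Thread S) : fiber S ι := ⟨base s, rfl⟩

theorem continuous_toFiber : Continuous (toFiber : (ι → Thread S) → fiber S ι) :=
  continuous_base.subtype_mk _

theorem toFiber_surjective : Function.Surjective (toFiber : (ι → Thread S) → fiber S ι) := by
  rintro ⟨x, hx⟩
  obtain ⟨s, rfl⟩ := exists_base_eq hx
  exact ⟨s, rfl⟩

theorem toFiber_eq_toFiber {s t : ι → Thread S} :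
    toFiber s = toFiber t ↔ ∀ i k, |s i k - t i k| ≤ 1 :=
  Subtype.ext_iff.trans base_eq_base

instance [Finite ι] : CompactSpace (fiber S ι) :=
  isCompact_iff_compactSpace.1 (isClosed_singleton.preimage continuous_height).isCompact

theorem fiber_nontrivial [Nonempty ι] : (fiber S ι).Nontrivial := by
  have hlen := S.len_eq 0
  obtain ⟨s, hs⟩ := Thread.exists_apply_eq (S := S) 0 (c := 0) ⟨le_rfl, by omega⟩
  obtain ⟨t, ht⟩ := Thread.exists_apply_eq (S := S) 0 (c := 5) ⟨by omega, by omega⟩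
  refine ⟨base fun _ => s, rfl, base fun _ => t, rfl, fun h => ?_⟩
  have := base_eq_base.1 h (Classical.arbitrary ι) 0
  rw [hs, ht] at this
  norm_num at this

theorem nonempty_homeomorph_of_same_fibers {X Y Z : Type*} [TopologicalSpace X]
    [TopologicalSpace Y] [TopologicalSpace Z] [CompactSpace X] [T2Space Y] [T2Space Z] {f : X → Y}
    {g : X → Z} (hf : Continuous f) (hf' : Function.Surjective f) (hg : Continuous g)
    (hg' : Function.Surjective g) (h : ∀ x x', f x = f x' ↔ g x = g x') : Nonempty (Y ≃ₜ Z) := by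
  obtain ⟨r, hr⟩ : ∃ r, r = Setoid.ker f := ⟨_, rfl⟩
  have e₁ : Nonempty (Quotient r ≃ₜ Y) := by
    rw [hr]
    exact ⟨Topology.IsQuotientMap.homeomorph (f := ⟨f, hf⟩) (hf.isClosedMap.isQuotientMap hf hf')⟩
  have e₂ : Nonempty (Quotient r ≃ₜ Z) := by
    rw [hr.trans (Setoid.ext h : Setoid.ker f = Setoid.ker g)]
    exact ⟨Topology.IsQuotientMap.homeomorph (f := ⟨g, hg⟩) (hg.isClosedMap.isQuotientMap hg hg')⟩
  exact ⟨e₁.some.symm.trans e₂.some⟩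

theorem nonempty_fiber_homeomorph_pi [Finite ι] :
    Nonempty (fiber S ι ≃ₜ (ι → fiber S Unit)) := by
  refine nonempty_homeomorph_of_same_fibers continuous_toFiber toFiber_surjective
    (g := fun s i => toFiber fun _ => s i)
    (continuous_pi fun i => continuous_toFiber.comp (by fun_prop)) (fun x => ?_) fun s t => ?_
  · choose s hs using fun i => toFiber_surjective (x i)
    exact ⟨fun i => s i (), funext hs⟩
  · simp [toFiber_eq_toFiber, funext_iff]

theorem exists_level_of_isOpen_fiber [Finite ι] {O : Set (fiber S ι × fiber S ι)} (hO : IsOpen O)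
    (h : ∀ x, (x, x) ∈ O) :
    ∃ n, ∀ s t : ι → Thread S, (∀ i, |s i n - t i n| ≤ 1) → (toFiber s, toFiber t) ∈ O := by
  refine Thread.exists_level_of_isOpen
    (hO.preimage (continuous_toFiber.prodMap continuous_toFiber)) fun s t hst => ?_
  have := h (toFiber s)
  nth_rewrite 2 [toFiber_eq_toFiber.2 hst] at this
  exact this

/-! ### The fibre is a pseudo-arc -/

instance : PreconnectedSpace (fiber S Unit) := by
  refine preconnectedSpace_iff_clopen.2 fun U hU => ?_
  obtain ⟨n, hn⟩ := exists_level_of_isOpen_fiber (O := U ×ˢ U ∪ Uᶜ ×ˢ Uᶜ)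
    ((hU.2.prod hU.2).union (hU.compl.2.prod hU.compl.2)) fun x => by
      by_cases hx : x ∈ U <;> simp [hx]
  have hn' : ∀ s t : Unit → Thread S, |s () n - t () n| ≤ 1 →
      (toFiber s ∈ U ↔ toFiber t ∈ U) := fun s t hst => by
    rcases hn s t fun _ => hst with h | h
    · exact iff_of_true h.1 h.2
    · exact iff_of_false h.1 h.2
  have key : ∀ c : ℤ, 0 ≤ c → ∀ s t : Unit → Thread S, s () n = 0 → t () n = c →
      (toFiber s ∈ U ↔ toFiber t ∈ U) := by
    intro c hc
    induction c, hc using Int.leInduction with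
    | base => exact fun s t hs ht => hn' s t (by simp [hs, ht])
    | succ c hc ih =>
      intro s t hs ht
      have hlen := ((t ()).mem_Icc n).2
      obtain ⟨r, hr⟩ := Thread.exists_apply_eq (S := S) n (c := c) ⟨hc, by omega⟩
      exact (ih s (fun _ => r) hs hr).trans (hn' _ _ (by rw [hr, ht]; simp))
  obtain ⟨s, hs⟩ := Thread.exists_apply_eq (S := S) n (c := 0)
    ⟨le_rfl, by rw [S.len_eq]; positivity⟩
  by_cases hsU : toFiber (fun _ => s) ∈ U
  · refine Or.inr (eq_univ_of_forall fun x => ?_)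
    obtain ⟨t, rfl⟩ := toFiber_surjective x
    exact (key _ ((t ()).mem_Icc n).1 (fun _ => s) t hs rfl).1 hsU
  · refine Or.inl (eq_empty_of_forall_notMem fun x => ?_)
    obtain ⟨t, rfl⟩ := toFiber_surjective x
    exact fun h => hsU ((key _ ((t ()).mem_Icc n).1 (fun _ => s) t hs rfl).2 h)

instance : ConnectedSpace (fiber S Unit) where
  toNonempty := fiber_nontrivial.nonempty.to_subtype

theorem isConnected_fiber [Finite ι] : IsConnected (fiber S ι) := by
  obtain ⟨e⟩ := nonempty_fiber_homeomorph_pi (S := S) (ι := ι)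
  exact isConnected_iff_connectedSpace.2 (e.symm.surjective.connectedSpace e.symm.continuous)

theorem isChainable_fiber : IsChainable (fiber S Unit) := by
  intro ε hε
  obtain ⟨n, hn⟩ := exists_level_of_isOpen_fiber (S := S) (ι := Unit)
    (O := {p | dist p.1 p.2 < ε}) (isOpen_lt continuous_dist continuous_const) (by simpa using hε)
  have hlen := S.len_eq (n + 1)
  -- the points all of whose level values are in the `j`-th link
  let U : ℕ → Set (fiber S Unit) := fun j =>
    (toFiber '' {s | s () (n + 1) ∈ Icc (3 * (j : ℤ)) (3 * j + 5)}ᶜ)ᶜ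
  have hU : ∀ {j s}, toFiber s ∈ U j ↔ ∀ t : Unit → Thread S, toFiber t = toFiber s →
      3 * (j : ℤ) ≤ t () (n + 1) ∧ t () (n + 1) ≤ 3 * j + 5 := fun {j s} =>
    ⟨fun h t ht => by_contra fun h' => h ⟨t, h', ht⟩, fun h ⟨t, h', ht⟩ => h' (h t ht)⟩
  have hrep : ∀ {s t : Unit → Thread S}, toFiber t = toFiber s →
      t () (n + 1) ≤ s () (n + 1) + 1 ∧ s () (n + 1) ≤ t () (n + 1) + 1 := fun h => by
    have := abs_le.1 (toFiber_eq_toFiber.1 h () (n + 1))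
    omega
  refine ⟨S.chain (n + 1), fun j => U j, fun j => ?_, fun j x hx y hy => ?_, ?_, fun i j => ?_⟩
  · have hcont : Continuous fun s : Unit → Thread S => s () (n + 1) :=
      (Thread.continuous_apply _).comp (continuous_apply ())
    exact (continuous_toFiber.isClosedMap _ (((isOpen_discrete _).preimage
      hcont).isClosed_compl)).isOpen_compl
  · obtain ⟨s, rfl⟩ := toFiber_surjective x
    obtain ⟨t, rfl⟩ := toFiber_surjective y
    have h1 := hU.1 hx s rfl
    have h2 := hU.1 hy t rfl
    have h3 : |s () (n + 1) - t () (n + 1)| ≤ 6 := abs_le.2 ⟨by omega, by omega⟩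
    exact (hn s t fun _ => Thread.abs_le_one_of_succ h3).le
  · refine eq_univ_of_forall fun x => ?_
    obtain ⟨s, rfl⟩ := toFiber_surjective x
    -- `c` is the least level value of the point
    obtain ⟨c, hc0, hc⟩ : ∃ c : ℤ, 0 ≤ c ∧ ∀ t : Unit → Thread S, toFiber t = toFiber s →
        c ≤ t () (n + 1) ∧ t () (n + 1) ≤ c + 1 := by
      by_cases h : ∃ r : Unit → Thread S, toFiber r = toFiber s ∧ r () (n + 1) < s () (n + 1)
      · obtain ⟨r, hr, hlt⟩ := h
        refine ⟨r () (n + 1), ((r ()).mem_Icc _).1, fun t ht => ?_⟩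
        have h1 := hrep ht
        have h2 := hrep (ht.trans hr.symm)
        omega
      · push Not at h
        exact ⟨s () (n + 1), ((s ()).mem_Icc _).1, fun t ht => ⟨h t ht, (hrep ht).1⟩⟩
    refine mem_iUnion.2 ⟨⟨min (c / 3).toNat (S.chain (n + 1)), by omega⟩, hU.2 fun t ht => ?_⟩
    have h1 := hc t ht
    have h2 := ((t ()).mem_Icc (n + 1)).2
    push_cast
    omega
  · constructor
    · rintro ⟨x, hi, hj⟩
      obtain ⟨s, rfl⟩ := toFiber_surjective x
      have h1 := hU.1 hi s rfl
      have h2 := hU.1 hj s rfl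
      omega
    · rintro ⟨hij, hji⟩
      have hi := i.2
      have hj := j.2
      obtain ⟨s, hs⟩ := Thread.exists_apply_eq (S := S) (n + 1)
        (c := 3 * max (i : ℤ) j + 1) ⟨by omega, by omega⟩
      refine ⟨toFiber fun _ => s, hU.2 fun t ht => ?_, hU.2 fun t ht => ?_⟩ <;>
      · have := hrep ht
        simp only [hs] at this
        omega

theorem exists_level_forall_notMem {s : Unit → Thread S} {B : Set (fiber S Unit)}
    (hB : IsClosed B) (hs : toFiber s ∉ B) :
    ∃ n, ∀ k, n ≤ k → ∀ r : Unit → Thread S, |r () k - s () k| ≤ 1 → toFiber r ∉ B := by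
  obtain ⟨n, hn⟩ := exists_level_of_isOpen_fiber (S := S) (ι := Unit) (O := (B ×ˢ {toFiber s})ᶜ)
    (hB.prod isClosed_singleton).isOpen_compl (by
      rintro x ⟨hx, rfl⟩
      exact hs hx)
  exact ⟨n, fun k hk r hr hrB => hn r s (fun _ => Thread.abs_le_one_of_le hk hr) ⟨hrB, rfl⟩⟩

theorem exists_toFiber_mem {A : Set (fiber S Unit)} (hA : IsPreconnected A) {k : ℕ}
    {s t : Unit → Thread S} (hs : toFiber s ∈ A) (ht : toFiber t ∈ A) {w : ℤ}
    (hw : s () k ≤ w ∧ w ≤ t () k ∨ t () k ≤ w ∧ w ≤ s () k) :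
    ∃ r : Unit → Thread S, toFiber r ∈ A ∧ r () k = w := by
  obtain ⟨r, ⟨x, hx, hxr⟩, hr⟩ := exists_base_mem (hA.image _ continuous_subtype_val.continuousOn)
    (i := ()) (k := k) (by
      rintro _ ⟨x, -, rfl⟩
      rw [x.2]
      positivity) ⟨_, hs, rfl⟩ ⟨_, ht, rfl⟩ hw
  exact ⟨r, (Subtype.ext hxr : x = toFiber r) ▸ hx, hr⟩

/-- If `K = A ∪ B` and `a ∈ A \ B`, `b ∈ B \ A`, then at a sufficiently high level crookedness
provides a value `c` near `b` and then a value `d` near `a` on the way from `a` to `b`. As `K` is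
connected, `c` is attained in `K`, hence in `B`; as `B` is connected, `d` is attained in `B`. -/
theorem isHereditarilyIndecomposable_fiber : IsHereditarilyIndecomposable (fiber S Unit) := by
  rintro K A B hK hA hB hAB
  by_contra! hcon
  obtain ⟨b, hbA, hbB⟩ : ∃ b, b ∉ A ∧ b ∈ B := by
    by_contra! h
    exact hcon.1 (hAB ▸ (union_eq_left.2 fun x hx => by_contra fun hx' => h x hx' hx).symm)
  obtain ⟨a, haB, haA⟩ : ∃ a, a ∉ B ∧ a ∈ A := by
    by_contra! h
    exact hcon.2 (hAB ▸ (union_eq_right.2 fun x hx => by_contra fun hx' => h x hx' hx).symm)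
  obtain ⟨s, rfl⟩ := toFiber_surjective a
  obtain ⟨t, rfl⟩ := toFiber_surjective b
  obtain ⟨n, hn⟩ := exists_level_forall_notMem hB.1.isClosed haB
  obtain ⟨n', hn'⟩ := exists_level_forall_notMem hA.1.isClosed hbA
  set k := max n n'
  obtain ⟨c, d, hc, hd, hcd⟩ := (s ()).exists_crooked (t ()) k
  obtain ⟨r, hrK, hr⟩ := exists_toFiber_mem hK.2.isPreconnected (k := k + 1)
    (hAB ▸ Or.inl haA : toFiber s ∈ K) (hAB ▸ Or.inr hbB : toFiber t ∈ K) (w := c) (by omega)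
  have hrB : toFiber r ∈ B := by
    rw [← hAB] at hrK
    refine hrK.resolve_left (hn' k (le_max_right _ _) r ?_)
    rwa [← (r ()).bond_eq k, hr]
  obtain ⟨r', hrB', hr'⟩ := exists_toFiber_mem hB.2.isPreconnected (k := k + 1) hrB hbB (w := d)
    (by omega)
  refine hn k (le_max_left _ _) r' ?_ hrB'
  rwa [← (r' ()).bond_eq k, hr']

theorem isPseudoArc_fiber : IsPseudoArc (fiber S Unit) where
  compact := inferInstance
  connected := inferInstance
  nontrivial := fiber_nontrivial.coe_sort
  chainable := isChainable_fiber
  hereditarilyIndecomposable := isHereditarilyIndecomposable_fiber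

end Cone

/-! ### A discrete Poincaré–Miranda theorem -/

section Cup

variable {κ : Type*} [DecidableEq κ]

/-- The cubical cup product (modulo `2`) of the coboundaries of the functions in a list, evaluated
on the cube with least vertex `v` and set of directions `D`. -/
def cupCoboundary : List ((κ → ℕ) → ZMod 2) → (κ → ℕ) → Finset κ → ZMod 2
  | [], _, _ => 1
  | ψ :: l, v, D => ∑ i ∈ D, (ψ (v + Pi.single i 1) - ψ v) *
      cupCoboundary l (v + Pi.single i 1) (D.erase i)

theorem sum_sum_erase_eq_zero_of_symm (D : Finset κ) (F : κ → κ → ZMod 2)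
    (hF : ∀ i j, F i j = F j i) : ∑ i ∈ D, ∑ j ∈ D.erase i, F i j = 0 := by
  rw [Finset.sum_sigma']
  refine Finset.sum_involution (fun p _ => ⟨p.2, p.1⟩) (fun p _ => ?_) (fun p hp _ h => ?_)
    (fun p hp => ?_) (fun p _ => rfl)
  · rw [hF p.2 p.1]
    exact CharTwo.add_self_eq_zero _
  · have h1 : p.2 = p.1 := congrArg Sigma.fst h
    simp [h1] at hp
  · simp only [Finset.mem_sigma, Finset.mem_erase] at hp ⊢
    exact ⟨hp.2.2, hp.2.1.symm, hp.1⟩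

theorem sum_sum_erase_comm (D : Finset κ) (F : κ → κ → ZMod 2) :
    ∑ i ∈ D, ∑ j ∈ D.erase i, F i j = ∑ j ∈ D, ∑ i ∈ D.erase j, F i j := by
  refine Finset.sum_comm' fun i j => ?_
  simp only [Finset.mem_erase]
  tauto

/-- The cup product of coboundaries is a cocycle. -/
theorem sum_cupCoboundary_add (l : List ((κ → ℕ) → ZMod 2)) (v : κ → ℕ) (D : Finset κ) :
    ∑ i ∈ D, cupCoboundary l (v + Pi.single i 1) (D.erase i) =
      ∑ i ∈ D, cupCoboundary l v (D.erase i) := by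
  induction l generalizing v D with
  | nil => rfl
  | cons ψ l ih =>
    simp only [cupCoboundary, sub_mul, Finset.sum_sub_distrib]
    have e1 : ∑ i ∈ D, ∑ j ∈ D.erase i, ψ (v + Pi.single i 1 + Pi.single j 1) *
        cupCoboundary l (v + Pi.single i 1 + Pi.single j 1) ((D.erase i).erase j) = 0 :=
      sum_sum_erase_eq_zero_of_symm D _ fun i j => by
        rw [add_right_comm, Finset.erase_right_comm]
    have e2 : ∑ i ∈ D, ∑ j ∈ D.erase i, ψ (v + Pi.single i 1) *
        cupCoboundary l (v + Pi.single i 1 + Pi.single j 1) ((D.erase i).erase j) =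
        ∑ i ∈ D, ∑ j ∈ D.erase i, ψ (v + Pi.single j 1) *
        cupCoboundary l (v + Pi.single j 1) ((D.erase i).erase j) := by
      refine (Finset.sum_congr rfl fun i _ => ?_).trans (sum_sum_erase_comm D fun i j =>
        ψ (v + Pi.single j 1) * cupCoboundary l (v + Pi.single j 1) ((D.erase i).erase j)).symm
      rw [← Finset.mul_sum, ih, Finset.mul_sum]
      exact Finset.sum_congr rfl fun j _ => by rw [Finset.erase_right_comm]
    have e3 : ∑ i ∈ D, ∑ j ∈ D.erase i, ψ v *
        cupCoboundary l (v + Pi.single j 1) ((D.erase i).erase j) = 0 := by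
      refine (Finset.sum_congr rfl fun i _ => ?_).trans
        (sum_sum_erase_eq_zero_of_symm D (fun i j => ψ v *
          cupCoboundary l v ((D.erase i).erase j)) fun i j => by rw [Finset.erase_right_comm])
      rw [← Finset.mul_sum, ih, Finset.mul_sum]
    rw [e1, e2, e3, zero_sub, sub_zero, CharTwo.neg_eq]

theorem cupCoboundary_eq_zero {ψ : (κ → ℕ) → ZMod 2} {c : ZMod 2}
    {l : List ((κ → ℕ) → ZMod 2)} (hψ : ψ ∈ l) {v : κ → ℕ} {D : Finset κ}
    (h : ∀ w : κ → ℕ, (∀ i, v i ≤ w i ∧ w i ≤ v i + 1 ∧ (i ∉ D → w i = v i)) → ψ w = c) :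
    cupCoboundary l v D = 0 := by
  induction l generalizing v D with
  | nil => simp at hψ
  | cons φ l ih =>
    refine Finset.sum_eq_zero fun i hi => ?_
    rcases List.mem_cons.1 hψ with rfl | hl
    · rw [h _ fun j => ?_, h v fun j => by simp, sub_self, zero_mul]
      rcases eq_or_ne j i with rfl | hj
      · simp [hi]
      · simp [hj]
    · rw [ih hl fun w hw => h w fun j => ?_, mul_zero]
      have := hw j
      rcases eq_or_ne j i with rfl | hj
      · simp only [Pi.add_apply, Pi.single_eq_same, Finset.notMem_erase, not_false_eq_true,
          forall_const] at this
        exact ⟨by omega, by omega, fun h => absurd hi h⟩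
      · simpa [hj] using this

variable [Fintype κ]

theorem mem_piFinset_update {t : κ → Finset ℕ} {j : κ} {A : Finset ℕ} {v : κ → ℕ} :
    v ∈ Fintype.piFinset (Function.update t j A) ↔ v j ∈ A ∧ ∀ i ≠ j, v i ∈ t i := by
  rw [Fintype.mem_piFinset, Function.forall_update_iff t fun i s => v i ∈ s]

theorem sum_piFinset_update_union (t : κ → Finset ℕ) (j : κ) {A B : Finset ℕ}
    (hAB : Disjoint A B) (H : (κ → ℕ) → ZMod 2) :
    ∑ v ∈ Fintype.piFinset (Function.update t j (A ∪ B)), H v =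
      ∑ v ∈ Fintype.piFinset (Function.update t j A), H v +
        ∑ v ∈ Fintype.piFinset (Function.update t j B), H v := by
  rw [← Finset.sum_union]
  · congr 1
    ext v
    simp only [Finset.mem_union, mem_piFinset_update]
    tauto
  · refine Finset.disjoint_left.2 fun v hA hB => ?_
    exact Finset.disjoint_left.1 hAB (mem_piFinset_update.1 hA).1 (mem_piFinset_update.1 hB).1

/-- Summing a difference in direction `j` over a box leaves the sums over two opposite faces. -/
theorem sum_piFinset_sub (t : κ → Finset ℕ) (j : κ) (N : ℕ) (H : (κ → ℕ) → ZMod 2) :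
    ∑ v ∈ Fintype.piFinset (Function.update t j (Finset.range N)),
        (H (v + Pi.single j 1) - H v) =
      ∑ v ∈ Fintype.piFinset (Function.update t j {N}), H v -
        ∑ v ∈ Fintype.piFinset (Function.update t j {0}), H v := by
  have e1 : ∑ v ∈ Fintype.piFinset (Function.update t j (Finset.range N)),
      H (v + Pi.single j 1) =
      ∑ v ∈ Fintype.piFinset (Function.update t j (Finset.Ioc 0 N)), H v := by
    refine Finset.sum_nbij' (fun v => v + Pi.single j 1) (fun v => v - Pi.single j 1)
      (fun v hv => ?_) (fun v hv => ?_) (fun v hv => ?_) (fun v hv => ?_) fun v _ => rfl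
    · rw [mem_piFinset_update] at hv ⊢
      refine ⟨?_, fun i hi => by simpa [hi] using hv.2 i hi⟩
      have := Finset.mem_range.1 hv.1
      simp only [Pi.add_apply, Pi.single_eq_same, Finset.mem_Ioc]
      omega
    · rw [mem_piFinset_update] at hv ⊢
      refine ⟨?_, fun i hi => by simpa [hi] using hv.2 i hi⟩
      have := Finset.mem_Ioc.1 hv.1
      simp only [Pi.sub_apply, Pi.single_eq_same, Finset.mem_range]
      omega
    · simp
    · rw [mem_piFinset_update] at hv
      ext i
      rcases eq_or_ne i j with rfl | hi
      · have := Finset.mem_Ioc.1 hv.1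
        simp only [Pi.add_apply, Pi.sub_apply, Pi.single_eq_same]
        omega
      · simp [hi]
  have e2 : Finset.range N ∪ {N} = Finset.Ioc 0 N ∪ {0} := by
    ext x
    simp only [Finset.mem_union, Finset.mem_range, Finset.mem_singleton, Finset.mem_Ioc]
    omega
  have h1 := sum_piFinset_update_union t j (A := Finset.range N) (B := {N}) (by simp) H
  have h2 := sum_piFinset_update_union t j (A := Finset.Ioc 0 N) (B := {0}) (by simp) H
  rw [e2, h2] at h1
  rw [Finset.sum_sub_distrib, e1]
  linear_combination h1

/-- Stokes' theorem for the cup product of the coboundaries of functions `ψ i` that are `0` on the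
lower and `1` on the upper face in direction `i`. -/
theorem sum_cupCoboundary_eq_one {N : ℕ} {ψ : κ → (κ → ℕ) → ZMod 2}
    (h₀ : ∀ i v, v i = 0 → ψ i v = 0) (h₁ : ∀ i v, v i = N → ψ i v = 1) (l : List κ)
    (hl : l.Nodup) :
    ∑ v ∈ Fintype.piFinset fun i => if i ∈ l then Finset.range N else {N},
      cupCoboundary (l.map ψ) v l.toFinset = 1 := by
  induction l with
  | nil => simp [cupCoboundary]
  | cons k l ih =>
    obtain ⟨hkl, hl'⟩ := List.nodup_cons.1 hl
    set t : κ → Finset ℕ := fun i => if i ∈ k :: l then Finset.range N else {N} with ht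
    set D := (k :: l).toFinset with hD
    let H : κ → (κ → ℕ) → ZMod 2 := fun j v => ψ k v * cupCoboundary (l.map ψ) v (D.erase j)
    have e1 : ∀ v, cupCoboundary ((k :: l).map ψ) v D =
        ∑ j ∈ D, (H j (v + Pi.single j 1) - H j v) := fun v => by
      simp only [List.map_cons, cupCoboundary, H, sub_mul, Finset.sum_sub_distrib]
      rw [← Finset.mul_sum, ← Finset.mul_sum, sum_cupCoboundary_add]
    have e2 : ∀ j ∈ D, ∑ v ∈ Fintype.piFinset t, (H j (v + Pi.single j 1) - H j v) =
        if j = k then 1 else 0 := by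
      intro j hj
      have htj : t j = Finset.range N := by
        simp only [ht, List.mem_toFinset.1 hj, if_true]
      conv_lhs => rw [← Function.update_eq_self j t, htj]
      rw [sum_piFinset_sub]
      split_ifs with hjk
      · subst hjk
        have b : ∑ v ∈ Fintype.piFinset (Function.update t j {0}), H j v = 0 :=
          Finset.sum_eq_zero fun v hv => by
            simp [H, h₀ j v (by simpa using (mem_piFinset_update.1 hv).1)]
        rw [b, sub_zero, ← ih hl']
        have ht' : Function.update t j {N} = fun i => if i ∈ l then Finset.range N else {N} := by
          ext1 i
          rcases eq_or_ne i j with rfl | hi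
          · simp [hkl]
          · simp [ht, hi]
        have hD' : D.erase j = l.toFinset := by
          simp [hD, hkl]
        rw [ht']
        refine Finset.sum_congr rfl fun v hv => ?_
        rw [← ht'] at hv
        simp only [H, hD']
        rw [h₁ j v (by simpa using (mem_piFinset_update.1 hv).1), one_mul]
      · -- on both faces in direction `j ≠ k` the function `ψ j` is constant
        have hjl : j ∈ l := by
          have := List.mem_toFinset.1 hj
          simpa [hjk] using this
        have b : ∀ v c, (∀ w : κ → ℕ, w j = v j → ψ j w = c) → H j v = 0 := fun v c h => by
          simp only [H]
          rw [cupCoboundary_eq_zero (List.mem_map_of_mem hjl)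
            (fun w hw => h w ((hw j).2.2 (Finset.notMem_erase _ _))), mul_zero]
        rw [Finset.sum_eq_zero fun v hv => b v 1 fun w hw => h₁ j w ?_,
          Finset.sum_eq_zero fun v hv => b v 0 fun w hw => h₀ j w ?_, sub_zero]
        · exact hw.trans (by simpa using (mem_piFinset_update.1 hv).1)
        · exact hw.trans (by simpa using (mem_piFinset_update.1 hv).1)
    rw [Finset.sum_congr rfl fun v _ => e1 v, Finset.sum_comm, Finset.sum_congr rfl e2,
      Finset.sum_ite_eq' D k, if_pos (by simp [hD])]

/-- If functions `ψ i` on the grid vanish on the lower face in direction `i` and are `1` on the upper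
one, then none of them is constant on a certain unit cube. -/
theorem exists_cube_forall_ne {N : ℕ} {ψ : κ → (κ → ℕ) → ZMod 2}
    (h₀ : ∀ i v, v i = 0 → ψ i v = 0) (h₁ : ∀ i v, v i = N → ψ i v = 1) :
    ∃ v : κ → ℕ, ∀ i, ∃ w : κ → ℕ, (∀ j, v j ≤ w j ∧ w j ≤ v j + 1) ∧ ψ i w ≠ ψ i v := by
  have h := sum_cupCoboundary_eq_one h₀ h₁ Finset.univ.toList (Finset.nodup_toList _)
  obtain ⟨v, -, hv⟩ := Finset.exists_ne_zero_of_sum_ne_zero (h.trans_ne one_ne_zero)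
  refine ⟨v, fun i => ?_⟩
  by_contra! hcon
  exact hv (cupCoboundary_eq_zero (List.mem_map_of_mem (by simp : i ∈ Finset.univ.toList))
    fun w hw => hcon w fun j => ⟨(hw j).1, (hw j).2.1⟩)

end Cup

/-! ### Covering dimension -/

/-- In dimension at most `n`, finite open covers are refined by `n + 1` families of disjoint open
sets. Given a refinement such that every point is in at most `n + 1` members, the `r`-th family
consists, for each set of `r` members, of the points that lie deeper in these members than in all
others. -/
theorem HasLebesgueDimLE.exists_disjoint_families {X : Type*} [PseudoEMetricSpace X] {n : ℕ}
    (hX : HasLebesgueDimLE X n) {U : Set (Set X)} (hU : U.Finite) (hUo : ∀ u ∈ U, IsOpen u)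
    (hUc : ⋃₀ U = univ) :
    ∃ W : Fin (n + 1) → Set (Set X), (∀ r, ∀ w ∈ W r, IsOpen w ∧ ∃ u ∈ U, w ⊆ u) ∧
      (∀ r, ∀ w ∈ W r, ∀ w' ∈ W r, ∀ x, x ∈ w → x ∈ w' → w = w') ∧
      ∀ x, ∃ r, ∃ w ∈ W r, x ∈ w := by
  classical
  obtain ⟨V, hV, hVo, hVc, hVU, hVn⟩ := hX U hU hUo hUc
  -- the depth of a point in a set
  let d : Set X → X → ENNReal := fun a x => Metric.infEDist x aᶜ
  have hd : ∀ a, Continuous (d a) := fun a => Metric.continuous_infEDist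
  have hd0 : ∀ a ∈ V, ∀ x, 0 < d a x ↔ x ∈ a := fun a ha x => by
    rw [pos_iff_ne_zero, Ne, ← Metric.mem_iff_infEDist_zero_of_closed (hVo a ha).isClosed_compl]
    simp
  let O : Finset (Set X) → Set X := fun s =>
    {x | ∀ a ∈ s, 0 < d a x ∧ ∀ b ∈ hV.toFinset \ s, d b x < d a x}
  refine ⟨fun r => O '' {s | s ⊆ hV.toFinset ∧ s.card = r + 1}, ?_, ?_, fun x => ?_⟩
  · rintro r _ ⟨s, ⟨hsV, hs⟩, rfl⟩
    constructor
    · have hO : O s = ⋂ a ∈ s, ({x | 0 < d a x} ∩ ⋂ b ∈ hV.toFinset \ s, {x | d b x < d a x}) := by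
        ext x
        simp [O]
      rw [hO]
      exact isOpen_biInter_finset fun a _ => (isOpen_lt continuous_const (hd a)).inter
        (isOpen_biInter_finset fun b _ => isOpen_lt (hd b) (hd a))
    · obtain ⟨a, ha⟩ : s.Nonempty := Finset.card_pos.1 (by omega)
      have haV := hV.mem_toFinset.1 (hsV ha)
      obtain ⟨u, hu, hau⟩ := hVU a haV
      exact ⟨u, hu, fun x hx => hau ((hd0 a haV x).1 (hx a ha).1)⟩
  · rintro r _ ⟨s, ⟨hsV, hs⟩, rfl⟩ _ ⟨t, ⟨htV, ht⟩, rfl⟩ x hx hx'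
    by_contra hne
    have hne' : s ≠ t := fun h => hne (h ▸ rfl)
    obtain ⟨a, ha, hat⟩ : ∃ a ∈ s, a ∉ t := Finset.not_subset.1 fun h =>
      hne' (Finset.eq_of_subset_of_card_le h (by omega))
    obtain ⟨b, hb, hbs⟩ : ∃ b ∈ t, b ∉ s := Finset.not_subset.1 fun h =>
      hne' (Finset.eq_of_subset_of_card_le h (by omega)).symm
    exact lt_asymm ((hx a ha).2 b (Finset.mem_sdiff.2 ⟨htV hb, hbs⟩))
      ((hx' b hb).2 a (Finset.mem_sdiff.2 ⟨hsV ha, hat⟩))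
  · let s : Finset (Set X) := hV.toFinset.filter fun a => x ∈ a
    have hs : s.card ≤ n + 1 := by
      have h := hVn x
      have hs' : {v ∈ V | x ∈ v} = (s : Set (Set X)) := by
        ext a
        simp [s]
      rw [hs', Set.encard_coe_eq_coe_finsetCard] at h
      exact_mod_cast h
    have hs0 : 0 < s.card := by
      obtain ⟨a, ha, hxa⟩ := mem_sUnion.1 (hVc ▸ mem_univ x : x ∈ ⋃₀ V)
      exact Finset.card_pos.2 ⟨a, by simp [s, ha, hxa]⟩
    refine ⟨⟨s.card - 1, by omega⟩, O s, ⟨s, ⟨Finset.filter_subset _ _, ?_⟩, rfl⟩,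
      fun a ha => ?_⟩
    · simp only
      omega
    · simp only [s, Finset.mem_filter, hV.mem_toFinset] at ha
      have h0 := (hd0 a ha.1 x).2 ha.2
      refine ⟨h0, fun b hb => ?_⟩
      simp only [s, Finset.mem_sdiff, Finset.mem_filter, hV.mem_toFinset, not_and] at hb
      have hb0 : d b x = 0 := nonpos_iff_eq_zero.1 (not_lt.1 fun h =>
        hb.2 hb.1 ((hd0 b hb.1 x).1 h))
      rwa [hb0]

theorem HasLebesgueDimLE.of_isClosed {X : Type*} [TopologicalSpace X] {n : ℕ}
    (hX : HasLebesgueDimLE X n) {F : Set X} (hF : IsClosed F) : HasLebesgueDimLE F n := by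
  intro U hU hUo hUc
  -- extend the members of the cover, add the complement of `F`, refine, and restrict
  let ext : Set F → Set X := fun u => (Subtype.val '' uᶜ)ᶜ
  have hext : ∀ (u : Set F) (x : F), (x : X) ∈ ext u ↔ x ∈ u := fun u x => by
    simp [ext]
  obtain ⟨V, hV, hVo, hVc, hVU, hVn⟩ := hX (insert Fᶜ (ext '' U)) ((hU.image _).insert _) (by
      rintro _ (rfl | ⟨u, hu, rfl⟩)
      · exact hF.isOpen_compl
      · exact (hF.isClosedMap_subtype_val _ (hUo u hu).isClosed_compl).isOpen_compl) (by
      refine eq_univ_of_forall fun x => ?_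
      by_cases hx : x ∈ F
      · obtain ⟨u, hu, hxu⟩ := mem_sUnion.1 (hUc ▸ mem_univ (⟨x, hx⟩ : F) : _ ∈ ⋃₀ U)
        exact ⟨ext u, Or.inr ⟨u, hu, rfl⟩, (hext u ⟨x, hx⟩).2 hxu⟩
      · exact ⟨_, Or.inl rfl, hx⟩)
  refine ⟨(fun v => Subtype.val ⁻¹' v) '' {v ∈ V | ∃ u ∈ U, v ⊆ ext u},
    (hV.subset (sep_subset _ _)).image _, ?_, ?_, ?_, fun x => ?_⟩
  · rintro _ ⟨v, ⟨hv, -⟩, rfl⟩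
    exact (hVo v hv).preimage continuous_subtype_val
  · refine eq_univ_of_forall fun x => ?_
    obtain ⟨v, hv, hxv⟩ := mem_sUnion.1 (hVc ▸ mem_univ (x : X) : (x : X) ∈ ⋃₀ V)
    obtain ⟨u, rfl | ⟨u, hu, rfl⟩, hvu⟩ := hVU v hv
    · exact absurd x.2 (hvu hxv)
    · exact ⟨_, ⟨v, ⟨hv, u, hu, hvu⟩, rfl⟩, hxv⟩
  · rintro _ ⟨v, ⟨-, u, hu, hvu⟩, rfl⟩
    exact ⟨u, hu, fun x hx => (hext u x).1 (hvu hx)⟩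
  · refine (encard_le_encard ?_).trans ((encard_image_le (fun v => Subtype.val ⁻¹' v) _).trans
      (hVn x))
    rintro _ ⟨⟨v, ⟨hv, -⟩, rfl⟩, hx⟩
    exact ⟨v, ⟨hv, hx⟩, rfl⟩

theorem le_lebesgueDim {X : Type*} [TopologicalSpace X] [Nonempty X] {m : ℕ}
    (h : ∀ n, HasLebesgueDimLE X n → m ≤ n) : (m : WithBot ℕ∞) ≤ lebesgueDim X := by
  rw [lebesgueDim, if_neg (not_isEmpty_of_nonempty X)]
  refine WithBot.coe_le_coe.2 (le_iInf fun n => ?_)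
  exact_mod_cast h n.1 n.2

/-- A chain of threads from level-zero value `0` to level-zero value `5`, adjacent at level `n`. -/
theorem Thread.exists_chain (S : CrookedSystem) (n : ℕ) :
    ∃ (N : ℕ) (y : ℕ → Thread S), y 0 0 = 0 ∧ y N 0 = 5 ∧
      ∀ x, |y x n - y (x + 1) n| ≤ 1 := by
  have hlen := S.len_eq 0
  obtain ⟨s, hs⟩ := Thread.exists_apply_eq (S := S) 0 (c := 0) ⟨le_rfl, by omega⟩
  obtain ⟨t, ht⟩ := Thread.exists_apply_eq (S := S) 0 (c := 5) ⟨by omega, by omega⟩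
  have hsn := s.mem_Icc n
  have htn := t.mem_Icc n
  have hy : ∀ x : ℕ, ∃ r : Thread S, r n =
      if s n ≤ t n then min (s n + x) (t n) else max (s n - x) (t n) := fun x =>
    Thread.exists_apply_eq n (by
      rw [Set.mem_Icc] at hsn htn ⊢
      split_ifs <;> omega)
  choose y hy using hy
  refine ⟨(t n - s n).natAbs, y, ?_, ?_, fun x => ?_⟩
  · refine (Thread.eq_of_le (t := s) (Nat.zero_le n) ?_).trans hs
    rw [hy]
    split_ifs <;> simp <;> omega
  · refine (Thread.eq_of_le (t := t) (Nat.zero_le n) ?_).trans ht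
    rw [hy]
    split_ifs <;> omega
  · rw [hy, hy]
    push_cast
    split_ifs <;> exact abs_le.2 ⟨by omega, by omega⟩

namespace Cone

variable {S : CrookedSystem} {ι : Type}

/-- The points of the fibre whose `i`-th coordinate has the level-zero value `c`. -/
def face (S : CrookedSystem) (i : ι) (c : ℤ) : Set (fiber S ι) := toFiber '' {s | s i 0 = c}

theorem isClosed_face [Finite ι] (i : ι) (c : ℤ) : IsClosed (face S i c) :=
  continuous_toFiber.isClosedMap _ (isClosed_eq
    ((Thread.continuous_apply 0).comp (continuous_apply i)) continuous_const)

theorem disjoint_face (i : ι) : Disjoint (face S i 0) (face S i 5) := by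
  refine disjoint_left.2 ?_
  rintro _ ⟨s, hs, rfl⟩ ⟨t, ht, hst⟩
  have h := toFiber_eq_toFiber.1 hst i 0
  rw [mem_ofPred_eq] at hs ht
  rw [hs, ht] at h
  norm_num at h

/-- The Lebesgue covering theorem for powers of the pseudo-arc. A cover none of whose members meets
two opposite faces cannot be refined by fewer than `card ι + 1` disjoint families: otherwise assign
to every family a direction `i`, and let `ψ i` tell whether a point lies in a member of the family
that meets the upper face in direction `i`. Pulled back to a fine grid, these functions contradict
the discrete Poincaré–Miranda theorem, because every unit cube lies in a member of some family. -/
theorem card_le_of_hasLebesgueDimLE [Fintype ι] {n : ℕ} (h : HasLebesgueDimLE (fiber S ι) n) :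
    Fintype.card ι ≤ n := by
  classical
  by_contra! hn
  obtain ⟨idx⟩ := Function.Embedding.nonempty_of_card_le (α := Fin (n + 1)) (β := ι) (by simpa)
  let U : Finset ι → Set (fiber S ι) := fun T =>
    (⋃ i, if i ∈ T then face S i 0 else face S i 5)ᶜ
  have hU : ∀ T x i, x ∈ U T → i ∈ T → x ∉ face S i 0 := fun T x i hx hi hf =>
    hx (mem_iUnion.2 ⟨i, by rwa [if_pos hi]⟩)
  have hU' : ∀ T x i, x ∈ U T → i ∉ T → x ∉ face S i 5 := fun T x i hx hi hf =>
    hx (mem_iUnion.2 ⟨i, by rwa [if_neg hi]⟩)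
  obtain ⟨W, hW, hWd, hWc⟩ := h.exists_disjoint_families (U := range U) (finite_range U) (by
      rintro _ ⟨T, rfl⟩
      refine (isClosed_iUnion_of_finite fun i => ?_).isOpen_compl
      split_ifs <;> exact isClosed_face i _) (by
      refine eq_univ_of_forall fun x => ⟨_, ⟨Finset.univ.filter fun i => x ∉ face S i 0, rfl⟩, ?_⟩
      simp only [U, mem_compl_iff, mem_iUnion, not_exists, Finset.mem_filter, Finset.mem_univ,
        true_and]
      intro i
      split_ifs with hi
      · exact disjoint_left.1 (disjoint_face i) hi
      · exact hi)
  obtain ⟨δ, hδ, hball⟩ := lebesgue_number_lemma_of_metric (isCompact_univ (X := fiber S ι))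
    (c := fun p : {p : Fin (n + 1) × Set (fiber S ι) // p.2 ∈ W p.1} => p.1.2)
    (fun p => (hW _ _ p.2).1) fun x _ => by
      obtain ⟨r, w, hw, hx⟩ := hWc x
      exact mem_iUnion.2 ⟨⟨(r, w), hw⟩, hx⟩
  obtain ⟨k, hk⟩ := exists_level_of_isOpen_fiber (S := S) (ι := ι)
    (O := {p | dist p.2 p.1 < δ}) (isOpen_lt (by fun_prop) continuous_const) fun x => by simpa using hδ
  obtain ⟨N, y, hy0, hyN, hy⟩ := Thread.exists_chain S k
  let X : (ι → ℕ) → fiber S ι := fun v => toFiber fun i => y (v i)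
  let P : ι → (ι → ℕ) → Prop := fun i v => X v ∈ face S i 5 ∨
    ∃ r, idx r = i ∧ ∃ w ∈ W r, X v ∈ w ∧ (w ∩ face S i 5).Nonempty
  obtain ⟨v, hv⟩ := exists_cube_forall_ne (N := N) (ψ := fun i v => if P i v then 1 else 0)
    (fun i v hvi => if_neg (by
      have hX : X v ∈ face S i 0 := ⟨_, by simp [hvi, hy0], rfl⟩
      rintro (hv | ⟨r, -, w, hw, hvw, x, hxw, hx⟩)
      · exact disjoint_left.1 (disjoint_face i) hX hv
      · obtain ⟨_, ⟨T, rfl⟩, hwT⟩ := (hW r w hw).2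
        by_cases hi : i ∈ T
        · exact hU T _ i (hwT hvw) hi hX
        · exact hU' T _ i (hwT hxw) hi hx))
    (fun i v hvi => if_pos (Or.inl ⟨_, by simp [hvi, hyN], rfl⟩))
  obtain ⟨⟨⟨r, w⟩, hw⟩, hb⟩ := hball (X v) (mem_univ _)
  obtain ⟨v', hv', hne⟩ := hv (idx r)
  have hX : ∀ v', (∀ j, v j ≤ v' j ∧ v' j ≤ v j + 1) → X v' ∈ w := fun v' hv' => by
    refine hb (hk _ _ fun j => ?_)
    rcases (by have := hv' j; omega : v' j = v j ∨ v' j = v j + 1) with h | h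
    · simp [h]
    · rw [h]
      exact hy _
  have hP : ∀ v', (∀ j, v j ≤ v' j ∧ v' j ≤ v j + 1) →
      (P (idx r) v' ↔ (w ∩ face S (idx r) 5).Nonempty) := fun v' hv' => by
    constructor
    · rintro (hf | ⟨r', hr', w', hw', hvw, hx⟩)
      · exact ⟨_, hX v' hv', hf⟩
      · obtain rfl := idx.injective hr'
        rwa [hWd _ w hw w' hw' _ (hX v' hv') hvw]
    · exact fun hx => Or.inr ⟨r, rfl, w, hw, hX v' hv', hx⟩
  exact hne (by simp only [hP v' hv', hP v fun j => ⟨le_rfl, Nat.le_succ _⟩])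

theorem le_lebesgueDim_fiber (S : CrookedSystem) (m : ℕ) (hm : 1 ≤ m) :
    (m : WithBot ℕ∞) ≤ lebesgueDim (fiber S (Fin m)) := by
  have : Nonempty (Fin m) := ⟨⟨0, hm⟩⟩
  have : Nonempty (fiber S (Fin m)) := fiber_nontrivial.nonempty.to_subtype
  exact le_lebesgueDim fun n hn => by simpa using card_le_of_hasLebesgueDimLE hn

end Cone

/-! ### Fibres and Euclidean targets -/

theorem IsPathIsometry.isometry_comp {X Y Z : Type*} [MetricSpace X] [MetricSpace Y]
    [MetricSpace Z] {g : Y → Z} (hg : Isometry g) {f : X → Y} (hf : IsPathIsometry f) :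
    IsPathIsometry (g ∘ f) := fun γ => by
  rw [hf γ]
  simp only [curveLength, eVariationOn, Function.comp_apply, hg.edist_eq]

theorem mainTheorem4 :
    -- a path isometry of a compact length space to the line with a pseudo-arc as a fibre
    (∃ (X : Type) (_ : MetricSpace X) (_ : CompactSpace X) (f : X → ℝ),
      IsLengthSpace X ∧ IsPathIsometry f ∧
      IsConnected (f ⁻¹' {0}) ∧ (f ⁻¹' {0}).Nontrivial ∧
      ∃ (P : Type) (_ : MetricSpace P), IsPseudoArc P ∧ Nonempty (↥(f ⁻¹' {0}) ≃ₜ P)) ∧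
    -- the dimension of the fibre can be arbitrarily large, with products of pseudo-arcs as fibres
    (∀ m : ℕ, 1 ≤ m → ∃ (X : Type) (_ : MetricSpace X) (_ : CompactSpace X) (f : X → ℝ),
      IsLengthSpace X ∧ IsPathIsometry f ∧
      IsConnected (f ⁻¹' {0}) ∧ (f ⁻¹' {0}).Nontrivial ∧
      (m : WithBot ℕ∞) ≤ lebesgueDim ↥(f ⁻¹' {0}) ∧
      ∃ (P : Type) (_ : MetricSpace P), IsPseudoArc P ∧
        Nonempty (↥(f ⁻¹' {0}) ≃ₜ (Fin m → P))) ∧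
    -- path isometries to `d`-dimensional Euclidean space do not bound the dimension by `d`
    (∀ d : ℕ, 1 ≤ d → ¬ ∀ (X : Type) [MetricSpace X] [CompactSpace X], IsLengthSpace X →
      (∃ f : X → EuclideanSpace ℝ (Fin d), IsPathIsometry f) →
        lebesgueDim X ≤ (d : WithBot ℕ∞)) := by
  obtain ⟨S⟩ := CrookedSystem.nonempty
  refine ⟨⟨Cone S Unit, inferInstance, inferInstance, Cone.height, Cone.isLengthSpace,
    Cone.isPathIsometry_height, Cone.isConnected_fiber, Cone.fiber_nontrivial,
    Cone.fiber S Unit, inferInstance, Cone.isPseudoArc_fiber, ⟨Homeomorph.refl _⟩⟩,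
    fun m hm => ?_, fun d hd hcon => ?_⟩
  · have : Nonempty (Fin m) := ⟨⟨0, hm⟩⟩
    exact ⟨Cone S (Fin m), inferInstance, inferInstance, Cone.height, Cone.isLengthSpace,
      Cone.isPathIsometry_height, Cone.isConnected_fiber, Cone.fiber_nontrivial,
      Cone.le_lebesgueDim_fiber S m hm, Cone.fiber S Unit, inferInstance, Cone.isPseudoArc_fiber,
      Cone.nonempty_fiber_homeomorph_pi⟩
  · -- a cone of dimension at least `d + 1`, mapped to a line in Euclidean space
    have hiso : Isometry fun x : ℝ => EuclideanSpace.single (⟨0, hd⟩ : Fin d) x :=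
      Isometry.of_dist_eq fun x y => PiLp.dist_single_same _ _ _ _ _
    have h := hcon (Cone S (Fin (d + 1))) Cone.isLengthSpace
      ⟨_, Cone.isPathIsometry_height.isometry_comp hiso⟩
    have : Nonempty (Cone S (Fin (d + 1))) := Cone.fiber_nontrivial.nonempty.to_type
    have h' : ((d + 1 : ℕ) : WithBot ℕ∞) ≤ lebesgueDim (Cone S (Fin (d + 1))) :=
      le_lebesgueDim fun n hn => by
        simpa using Cone.card_le_of_hasLebesgueDimLE
          (hn.of_isClosed (isClosed_singleton.preimage Cone.continuous_height))
    have := h'.trans h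
    norm_cast at this
    omega
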